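/- Let $p$ be a prime, let $\mathbb T\subset\mathbb C$ be the unit circle group and let $S_p=\{(y_0,y_1,\dots)\in\mathbb T^\infty: y_j=y_{j+1}^p \text{ for all } j\ge 0\}$ be the $p$-adic solenoid, a compact Abelian group with identity $e$ and continuous characters $\chi_{d,\ell}(y)=y_d^\ell$ ($d\ge 0$, $\ell\in\mathbb Z$). Notation. Let $\arg:\mathbb T\to[-\pi,\pi)$ satisfy $\mathrm e^{i\arg z}=z$, and let $h:\mathbb R\to\mathbb R$ be $h(x)=-x-\pi$ on $[-\pi,-\pi/2)$, $h(x)=x$ on $[-\pi/2,\pi/2)$, $h(x)=-x+\pi$ on $[\pi/2,\pi)$, and $h(x)=0$ elsewhere. For a locally compact, second countable, Hausdorff Abelian group $G$ with character group $\widehat G$: * A measure $\eta$ on the Borel sets of $G$ with values in $[0,\infty]$ is a Lévy measure if $\eta(\{e\})=0$, $\eta(G\setminus U)<\infty$ for every Borel neighbourhood $U$ of the identity, and $\int_G(1-\Re\chi)\,\mathrm d\eta<\infty$ for all $\chi\in\widehat G$. * For a Lévy measure $\eta$ and $g:G\times\widehat G\to\mathbb R$ (here one of the two functions below), $\pi_{\eta,g}$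 is the probability measure with $\int_G\chi\,\mathrm d\pi_{\eta,g}=\exp\int_G(\chi(x)-1-ig(x,\chi))\,\mathrm d\eta(x)$ for all $\chi\in\widehat G$. * A quadratic form on $\widehat G$ is a continuous $\psi:\widehat G\to[0,\infty)$ with $\psi(\chi_1\chi_2)+\psi(\chi_1\chi_2^{-1})=2(\psi(\chi_1)+\psi(\chi_2))$, and $\gamma_\psi$ is the probability measure with $\int_G\chi\,\mathrm d\gamma_\psi=\mathrm e^{-\psi(\chi)/2}$ for all $\chi\in\widehat G$. On $S_p$ put $\psi_b(\chi_{d,\ell})=b\ell^2/p^{2d}$ for $b\ge 0$ and $g_{S_p}(y,\chi_{d,\ell})=\ell\,h(\arg y_0)/p^d$. On $\mathbb R\times\mathbb Z^n$, with characters $\chi_{y,z}(x,\ell)=\mathrm e^{iyx}z_1^{\ell_1}\cdots z_n^{\ell_n}$ ($y\in\mathbb R$, $z\in\mathbb T^n$), put $g_{\mathbb R\times\mathbb Z^n}((x,\ell),\chi_{y,z})=y\,h(x)$. Define $\varphi:\mathbb R\times\mathbb Z^\infty\to S_p$ and $\tau:S_p\to\mathbb R\times\mathbb Z^\infty$ by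 $$\varphi(y_0,y_1,\dots)_j=\exp\bigl(i(y_0+2\pi y_1+2\pi y_2p+\dots+2\pi y_jp^{j-1})/p^j\bigr),\qquad \tau(x)_0=\arg x_0,\quad \tau(x)_j=\frac{p\arg x_j-\arg x_{j-1}}{2\pi}\ (j\ge 1).$$ For a Lévy measure $\eta$ on $S_p$ let $\eta_{n+1}$ be the measure on $\mathbb R\times\mathbb Z^n$ with $\eta_{n+1}(\{0\})=0$ and $\eta_{n+1}(B\times\{\ell\})=\eta(\{x\in S_p:\tau(x)_0\in B,\ (\tau(x)_1,\dots,\tau(x)_n)=\ell\})$ for Borel $B\subset\mathbb R$ and $\ell\in\mathbb Z^n$ with $0\notin B\times\{\ell\}$. **Theorem.** 1. $\varphi$ is a continuous surjective homomorphism, where $\mathbb R\times\mathbb Z^\infty$ carries the product topology. 2. Let $a\in S_p$, let $b\ge 0$, and let $\eta$ be a Lévy measure on $S_p$. Then $\psi_b$ is a quadratic form on $\widehat S_p$, every $\eta_{n+1}$ ($n\ge 0$) is a Lévy measure on $\mathbb R\times\mathbb Z^n$, and the measures $\gamma_{\psi_b}$, $\pi_{\eta,g_{S_p}}$ and $\pi_{\eta_{n+1},g_{\mathbb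 R\times\mathbb Z^n}}$ exist and are unique. There exist real random variables $X_0,Y_0$ and integer-valued random variables $Y_1,Y_2,\dots$ on some probability space such that $X_0$ is independent of the sequence $(Y_0,Y_1,\dots)$, $X_0$ is normal with mean $0$ and variance $b$, and $(Y_0,\dots,Y_n)$ has distribution $\pi_{\eta_{n+1},g_{\mathbb R\times\mathbb Z^n}}$ for every $n\ge 0$. For all such random variables, $$\varphi(\tau(a)_0+X_0+Y_0,\ \tau(a)_1+Y_1,\ \tau(a)_2+Y_2,\dots)=\Bigl(a_0\mathrm e^{i(X_0+Y_0)},\ a_1\mathrm e^{i(X_0+Y_0+2\pi Y_1)/p},\ a_2\mathrm e^{i(X_0+Y_0+2\pi Y_1+2\pi Y_2p)/p^2},\dots\Bigr),$$ and the distribution of this random element of $S_p$ is $\delta_a*\gamma_{\psi_b}*\pi_{\eta,g_{S_p}}$. 3. There exist independent random variables $U_0,U_1,\dots$ such that $U_0$ is uniformly distributed on $[0,2\pi]$ and $U_1,U_2,\dots$ are uniformly distributed on $\{0,1,\dots,p-1\}$. For all such random variables, the distribution of $\varphi(U_0,U_1,\dots)$ is the normalized Haar measure $\omega_{S_p}$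 of $S_p$. -/

import Mathlib

open MeasureTheory Topology
open scoped NNReal ENNReal

noncomputable section

/-! ### Measures on topological Abelian groups described by Fourier transforms

Groups are written multiplicatively; `PontryaginDual G` is the group of continuous homomorphisms
from `G` to the unit circle. -/

section General

variable {G : Type*} [CommGroup G] [TopologicalSpace G] [MeasurableSpace G]

/-- The Fourier transform `χ ↦ ∫ χ dμ` of a measure on `G`. -/
def fourierTransform (μ : Measure G) (χ : PontryaginDual G) : ℂ :=
  ∫ x, ((χ x : Circle) : ℂ) ∂μ

/-- Quadratic forms on the character group: nonnegative continuous functions that satisfy the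
parallelogram identity. -/
structure IsQuadraticForm (ψ : PontryaginDual G → ℝ) : Prop where
  nonneg : ∀ χ, 0 ≤ ψ χ
  continuous : Continuous ψ
  parallelogram : ∀ χ₁ χ₂, ψ (χ₁ * χ₂) + ψ (χ₁ * χ₂⁻¹) = 2 * (ψ χ₁ + ψ χ₂)

/-- Lévy measures on `G`: measures with values in `[0, ∞]` without mass at the identity, finite
off every Borel neighbourhood of the identity, and with `∫ (1 - Re χ) dη < ∞` for every
character `χ`. -/
structure IsLevyMeasure (η : Measure G) : Prop where
  one : η {1} = 0
  compl_nhds : ∀ U : Set G, MeasurableSet U → U ∈ 𝓝 (1 : G) → η Uᶜ < ∞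
  char : ∀ χ : PontryaginDual G, ∫⁻ x, ENNReal.ofReal (1 - ((χ x : Circle) : ℂ).re) ∂η < ∞

/-- `γ` is the symmetric Gauss measure belonging to the quadratic form `ψ`: the probability measure
with Fourier transform `exp (-ψ / 2)`. -/
structure IsGaussMeasure (ψ : PontryaginDual G → ℝ) (γ : Measure G) : Prop where
  prob : IsProbabilityMeasure γ
  fourier : ∀ χ, fourierTransform γ χ = Complex.exp (-(ψ χ : ℂ) / 2)

/-- `μ` is the generalized Poisson measure `π_{η, g}` of the Lévy measure `η` with respect to the
function `g` (below always one of two explicit local inner products): the probability measure with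
Fourier transform `χ ↦ exp ∫ (χ x - 1 - i g(x, χ)) dη(x)`, where the integral converges absolutely. -/
structure IsGenPoissonMeasure (η : Measure G) (g : G → PontryaginDual G → ℝ) (μ : Measure G) :
    Prop where
  prob : IsProbabilityMeasure μ
  integrable : ∀ χ : PontryaginDual G,
    Integrable (fun x => ((χ x : Circle) : ℂ) - 1 - Complex.I * (g x χ : ℂ)) η
  fourier : ∀ χ : PontryaginDual G, fourierTransform μ χ =
    Complex.exp (∫ x, (((χ x : Circle) : ℂ) - 1 - Complex.I * (g x χ : ℂ)) ∂η)

end General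

/-! ### The argument and the truncation function -/

/-- The argument of a point of the unit circle, with values in `[-π, π)`. -/
def circleArg (z : Circle) : ℝ :=
  if Complex.arg (z : ℂ) = Real.pi then -Real.pi else Complex.arg (z : ℂ)

theorem circleArg_mem (z : Circle) : circleArg z ∈ Set.Ico (-Real.pi) Real.pi := by
  unfold circleArg
  have h1 := Complex.neg_pi_lt_arg (z : ℂ)
  have h2 := Complex.arg_le_pi (z : ℂ)
  have h3 := Real.pi_pos
  split_ifs with h
  · constructor <;> linarith
  · exact ⟨h1.le, lt_of_le_of_ne h2 h⟩

theorem exp_circleArg (z : Circle) : Circle.exp (circleArg z) = z := by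
  unfold circleArg
  split_ifs with h
  · rw [← Circle.exp_arg z, h]
    exact (Circle.exp_eq_exp).2 ⟨-1, by push_cast; ring⟩
  · exact Circle.exp_arg z

/-- The piecewise linear truncation function `h` on the real line. -/
def truncFun (x : ℝ) : ℝ :=
  if x < -Real.pi ∨ Real.pi ≤ x then 0
  else if x < -(Real.pi / 2) then -x - Real.pi
  else if x < Real.pi / 2 then x
  else -x + Real.pi

/-! ### The `p`-adic solenoid -/

/-- The `p`-adic solenoid `{(y₀, y₁, …) : y_j = y_{j+1} ^ p}` as a subgroup of `𝕋^∞`; its type of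
elements carries the subspace topology. -/
def solenoid (p : ℕ) : Subgroup (ℕ → Circle) where
  carrier := {y | ∀ j, y j = y (j + 1) ^ p}
  mul_mem' := by
    intro a b ha hb j
    simp only [Pi.mul_apply, mul_pow, ← ha j, ← hb j]
  one_mem' := by intro j; simp
  inv_mem' := by
    intro a ha j
    simp only [Pi.inv_apply, inv_pow, ← ha j]

instance solenoid.measurableSpace (p : ℕ) : MeasurableSpace (solenoid p) := borel _

instance solenoid.borelSpace (p : ℕ) : BorelSpace (solenoid p) := ⟨rfl⟩

instance solenoid.compactSpace (p : ℕ) : CompactSpace (solenoid p) := by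
  have h : (solenoid p : Set (ℕ → Circle)) = ⋂ j, {y | y j = y (j + 1) ^ p} := by
    ext y; simp [solenoid]
  have hc : IsClosed (solenoid p : Set (ℕ → Circle)) := by
    rw [h]
    exact isClosed_iInter fun j => isClosed_eq (by fun_prop) (by fun_prop)
  exact isCompact_iff_compactSpace.mp hc.isCompact

/-- The normalized Haar measure of the (compact) solenoid. -/
def solenoidHaar (p : ℕ) : Measure (solenoid p) := Measure.haarMeasure ⊤

/-- The map `φ : ℝ × ℤ^∞ → S_p`,
`φ(y₀, y₁, …)_j = exp (i (y₀ + 2π y₁ + 2π y₂ p + ⋯ + 2π y_j p^{j-1}) / p^j)`. The second component of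
the argument is the sequence `k ↦ y_{k+1}`. -/
def solenoidMap (p : ℕ) [hp : Fact p.Prime] (y : ℝ × (ℕ → ℤ)) : solenoid p :=
  ⟨fun j => Circle.exp
      ((y.1 + ∑ k ∈ Finset.range j, 2 * Real.pi * (y.2 k : ℝ) * (p : ℝ) ^ k) / (p : ℝ) ^ j), by
    intro j
    have hp0 : (p : ℝ) ≠ 0 := by exact_mod_cast hp.out.ne_zero
    rw [← Circle.exp_natCast_mul]
    refine (Circle.exp_eq_exp).2 ⟨-(y.2 j), ?_⟩
    rw [Finset.sum_range_succ]
    push_cast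
    field_simp
    ring⟩

/-- The map `τ : S_p → ℝ × ℤ^∞`, `τ(x)₀ = arg x₀` and `τ(x)_j = (p arg x_j - arg x_{j-1}) / (2π)` for
`j ≥ 1` (an integer, see `solenoidTau_cast`). The second component is `k ↦ τ(x)_{k+1}`. -/
def solenoidTau (p : ℕ) (x : solenoid p) : ℝ × (ℕ → ℤ) :=
  (circleArg (x.1 0),
    fun k => ⌊(p * circleArg (x.1 (k + 1)) - circleArg (x.1 k)) / (2 * Real.pi)⌋)

theorem solenoidTau_cast (p : ℕ) (x : solenoid p) (k : ℕ) :
    (((solenoidTau p x).2 k : ℤ) : ℝ) =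
      (p * circleArg (x.1 (k + 1)) - circleArg (x.1 k)) / (2 * Real.pi) := by
  have h : Circle.exp (p * circleArg (x.1 (k + 1))) = Circle.exp (circleArg (x.1 k)) := by
    rw [Circle.exp_natCast_mul, exp_circleArg, exp_circleArg]
    exact (x.2 k).symm
  obtain ⟨m, hm⟩ := (Circle.exp_eq_exp).1 h
  have hm' : (p * circleArg (x.1 (k + 1)) - circleArg (x.1 k)) / (2 * Real.pi) = (m : ℝ) := by
    rw [hm]
    have := Real.pi_ne_zero
    field_simp
    ring
  simp only [solenoidTau, hm', Int.floor_intCast]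

/-! ### The groups `ℝ × ℤ^n` -/

/-- The group `ℝ × ℤ^n`, written multiplicatively. -/
abbrev RZ (n : ℕ) : Type := Multiplicative (ℝ × (Fin n → ℤ))

instance RZ.measurableSpace (n : ℕ) : MeasurableSpace (RZ n) :=
  inferInstanceAs (MeasurableSpace (ℝ × (Fin n → ℤ)))

instance RZ.borelSpace (n : ℕ) : BorelSpace (RZ n) :=
  inferInstanceAs (BorelSpace (ℝ × (Fin n → ℤ)))

/-- The projection `(y₀, y₁, …) ↦ (y₀, …, y_n)` of `ℝ × ℤ^∞` onto `ℝ × ℤ^n`. -/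
def firstCoords (n : ℕ) (y : ℝ × (ℕ → ℤ)) : RZ n :=
  Multiplicative.ofAdd (y.1, fun k : Fin n => y.2 k)

/-- The character `χ_{y,z}(x, ℓ) = e^{iyx} z₁^{ℓ₁} ⋯ z_n^{ℓ_n}` of `ℝ × ℤ^n`. -/
def rzChar (n : ℕ) (y : ℝ) (z : Fin n → Circle) : PontryaginDual (RZ n) :=
  show RZ n →ₜ* Circle from
  { toFun := fun v => Circle.exp (y * (Multiplicative.toAdd v).1) *
      ∏ k, z k ^ ((Multiplicative.toAdd v).2 k)
    map_one' := by simp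
    map_mul' := by
      intro v w
      simp only [toAdd_mul, Prod.fst_add, Prod.snd_add, Pi.add_apply, mul_add, Circle.exp_add,
        zpow_add, Finset.prod_mul_distrib]
      exact mul_mul_mul_comm _ _ _ _
    continuous_toFun := by
      have h : Continuous fun v : ℝ × (Fin n → ℤ) =>
          Circle.exp (y * v.1) * ∏ k, z k ^ (v.2 k) := by
        refine Continuous.mul (by fun_prop) (continuous_finsetProd _ fun k _ => ?_)
        exact (continuous_of_discreteTopology (f := fun m : ℤ => z k ^ m)).comp
          ((continuous_apply k).comp continuous_snd)
      exact h }

theorem rzChar_apply (n : ℕ) (y : ℝ) (z : Fin n → Circle) (v : RZ n) :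
    rzChar n y z v = Circle.exp (y * (Multiplicative.toAdd v).1) *
      ∏ k, z k ^ ((Multiplicative.toAdd v).2 k) := rfl

theorem eq_of_exp_mul_eq {a b : ℝ} (h : ∀ t : ℝ, Circle.exp (a * t) = Circle.exp (b * t)) :
    a = b := by
  by_contra hab
  have hab' : a - b ≠ 0 := sub_ne_zero.2 hab
  obtain ⟨m, hm⟩ := (Circle.exp_eq_exp).1 (h (Real.pi / (a - b)))
  have h1 : Real.pi = (m : ℝ) * (2 * Real.pi) := by
    have h2 : (a - b) * (Real.pi / (a - b)) = Real.pi := by field_simp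
    linarith
  have h3 : (1 : ℝ) = 2 * m := by
    have := Real.pi_pos
    nlinarith
  have h4 : (1 : ℤ) = 2 * m := by exact_mod_cast h3
  omega

open scoped Classical in
/-- The real parameter `y` of a character `χ_{y,z}` of `ℝ × ℤ^n` (all characters are of this form). -/
def rzFreq (n : ℕ) (χ : PontryaginDual (RZ n)) : ℝ :=
  if h : ∃ y : ℝ, ∃ z : Fin n → Circle, χ = rzChar n y z then h.choose else 0

theorem rzFreq_rzChar (n : ℕ) (y : ℝ) (z : Fin n → Circle) : rzFreq n (rzChar n y z) = y := by
  have h : ∃ y' : ℝ, ∃ z' : Fin n → Circle, rzChar n y z = rzChar n y' z' := ⟨y, z, rfl⟩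
  unfold rzFreq
  rw [dif_pos h]
  obtain ⟨z', hz'⟩ := h.choose_spec
  symm
  refine eq_of_exp_mul_eq fun t => ?_
  have := congrArg (fun χ : PontryaginDual (RZ n) => χ (Multiplicative.ofAdd (t, 0))) hz'
  simpa [rzChar_apply] using this

/-- The local inner product `g((x, ℓ), χ_{y,z}) = y h(x)` of `ℝ × ℤ^n`. -/
def rzInner (n : ℕ) (v : RZ n) (χ : PontryaginDual (RZ n)) : ℝ :=
  rzFreq n χ * truncFun (Multiplicative.toAdd v).1

/-! ### Characters, quadratic forms and the local inner product of the solenoid -/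

/-- The character `χ_{d,ℓ}(y) = y_d ^ ℓ` of the solenoid. -/
def solenoidChar (p d : ℕ) (ℓ : ℤ) : PontryaginDual (solenoid p) :=
  show solenoid p →ₜ* Circle from
  { toFun := fun y => y.1 d ^ ℓ
    map_one' := by simp
    map_mul' := by intro x y; simp [mul_zpow]
    continuous_toFun := ((continuous_apply d).comp continuous_subtype_val).zpow ℓ }

theorem solenoidChar_apply (p d : ℕ) (ℓ : ℤ) (y : solenoid p) :
    solenoidChar p d ℓ y = y.1 d ^ ℓ := rfl

open scoped Classical in
/-- The number `ℓ / p^d` for a character `χ_{d,ℓ}` of the solenoid (all characters are of this form, and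
the number does not depend on the choice of `d, ℓ`). -/
def solenoidFreq (p : ℕ) (χ : PontryaginDual (solenoid p)) : ℝ :=
  if h : ∃ q : ℕ × ℤ, χ = solenoidChar p q.1 q.2 then
    (h.choose.2 : ℝ) / (p : ℝ) ^ h.choose.1 else 0

theorem solenoidFreq_solenoidChar (p : ℕ) [Fact p.Prime] (d : ℕ) (ℓ : ℤ) :
    solenoidFreq p (solenoidChar p d ℓ) = (ℓ : ℝ) / (p : ℝ) ^ d := by
  have h : ∃ q : ℕ × ℤ, solenoidChar p d ℓ = solenoidChar p q.1 q.2 := ⟨(d, ℓ), rfl⟩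
  unfold solenoidFreq
  rw [dif_pos h]
  symm
  refine eq_of_exp_mul_eq fun t => ?_
  have := congrArg (fun χ : PontryaginDual (solenoid p) => χ (solenoidMap p (t, 0))) h.choose_spec
  simp only [solenoidChar_apply, solenoidMap, Pi.zero_apply, Int.cast_zero, mul_zero, zero_mul,
    Finset.sum_const_zero, add_zero, ← Circle.exp_intCast_mul] at this
  rw [div_mul_eq_mul_div, div_mul_eq_mul_div, ← mul_div_assoc', ← mul_div_assoc']
  exact this

/-- The quadratic form `ψ_b(χ_{d,ℓ}) = b ℓ² / p^{2d}` on the character group of the solenoid. -/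
def solenoidForm (p : ℕ) (b : ℝ≥0) (χ : PontryaginDual (solenoid p)) : ℝ :=
  b * solenoidFreq p χ ^ 2

theorem solenoidForm_solenoidChar (p : ℕ) [Fact p.Prime] (b : ℝ≥0) (d : ℕ) (ℓ : ℤ) :
    solenoidForm p b (solenoidChar p d ℓ) = b * (ℓ : ℝ) ^ 2 / (p : ℝ) ^ (2 * d) := by
  rw [solenoidForm, solenoidFreq_solenoidChar, div_pow, ← pow_mul, mul_comm d 2, mul_div_assoc]

/-- The local inner product `g(y, χ_{d,ℓ}) = ℓ h(arg y₀) / p^d` of the solenoid. -/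
def solenoidInner (p : ℕ) (y : solenoid p) (χ : PontryaginDual (solenoid p)) : ℝ :=
  solenoidFreq p χ * truncFun (circleArg (y.1 0))

theorem solenoidInner_solenoidChar (p : ℕ) [Fact p.Prime] (y : solenoid p) (d : ℕ) (ℓ : ℤ) :
    solenoidInner p y (solenoidChar p d ℓ) =
      (ℓ : ℝ) * truncFun (circleArg (y.1 0)) / (p : ℝ) ^ d := by
  rw [solenoidInner, solenoidFreq_solenoidChar, div_mul_eq_mul_div]

/-! ### The measures `η_{n+1}` -/

/-- The measure `η_{n+1}` on `ℝ × ℤ^n`: the image of `η` under `x ↦ (τ(x)₀, …, τ(x)_n)`, with the mass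
at the origin removed. -/
def levyImage (p n : ℕ) (η : Measure (solenoid p)) : Measure (RZ n) :=
  (η.map fun x => firstCoords n (solenoidTau p x)).restrict {1}ᶜ

theorem measurable_circleArg_coord (p k : ℕ) :
    Measurable fun x : solenoid p => circleArg (x.1 k) := by
  have h : Measurable fun x : solenoid p => Complex.arg ((x.1 k : Circle) : ℂ) :=
    Complex.measurable_arg.comp
      ((by fun_prop : Continuous fun z : Circle => (z : ℂ)).comp
        ((continuous_apply k).comp continuous_subtype_val)).measurable
  exact Measurable.ite (measurableSet_eq_fun h measurable_const) measurable_const h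

theorem measurable_firstCoords_tau (p n : ℕ) :
    Measurable fun x : solenoid p => firstCoords n (solenoidTau p x) := by
  have h : Measurable fun x : solenoid p =>
      ((solenoidTau p x).1, fun k : Fin n => (solenoidTau p x).2 k) := by
    refine Measurable.prodMk (measurable_circleArg_coord p 0) (measurable_pi_lambda _ fun k => ?_)
    exact ((((measurable_circleArg_coord p (k + 1)).const_mul _).sub
      (measurable_circleArg_coord p k)).div_const _).floor
  exact h

theorem levyImage_one (p n : ℕ) (η : Measure (solenoid p)) : levyImage p n η {1} = 0 := by
  rw [levyImage, Measure.restrict_apply (measurableSet_singleton _)]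
  simp

theorem levyImage_prod (p n : ℕ) (η : Measure (solenoid p)) (B : Set ℝ) (hB : MeasurableSet B)
    (ℓ : Fin n → ℤ) (h0 : (0 : ℝ × (Fin n → ℤ)) ∉ B ×ˢ ({ℓ} : Set (Fin n → ℤ))) :
    levyImage p n η (Multiplicative.toAdd ⁻¹' (B ×ˢ ({ℓ} : Set (Fin n → ℤ)))) =
      η {x | (solenoidTau p x).1 ∈ B ∧ (fun k : Fin n => (solenoidTau p x).2 k) = ℓ} := by
  have hS : MeasurableSet (Multiplicative.toAdd ⁻¹' (B ×ˢ ({ℓ} : Set (Fin n → ℤ))) : Set (RZ n)) :=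
    hB.prod (measurableSet_singleton ℓ)
  rw [levyImage, Measure.restrict_apply hS, Set.inter_eq_left.2,
    Measure.map_apply (measurable_firstCoords_tau p n) hS]
  · rfl
  · rintro v hv rfl
    exact h0 hv

/-! ### The random variables -/

section Random

variable {Ω : Type*} [MeasurableSpace Ω]

/-- The conditions on the random variables `X₀` and `Y = (Y₀, (Y₁, Y₂, …))`: `X₀` is `N(0, b)`, it is
independent of `Y`, and `(Y₀, …, Y_n)` has the law `π_{η_{n+1}, g}` on `ℝ × ℤ^n` for every `n`. -/
structure IsGaussPoissonPair (p : ℕ) (b : ℝ≥0) (η : Measure (solenoid p)) (P : Measure Ω)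
    (X₀ : Ω → ℝ) (Y : Ω → ℝ × (ℕ → ℤ)) : Prop where
  measurable_X : Measurable X₀
  measurable_Y : Measurable Y
  indep : ProbabilityTheory.IndepFun X₀ Y P
  law_X : P.map X₀ = ProbabilityTheory.gaussianReal 0 b
  law_Y : ∀ n, IsGenPoissonMeasure (levyImage p n η) (rzInner n)
    (P.map fun ω => firstCoords n (Y ω))

/-- The sequence of real random variables `U₀, U₁, U₂, …`, where `U k` stands for `U_{k+1}`. -/
def realSeq (U₀ : Ω → ℝ) (U : ℕ → Ω → ℤ) : ℕ → Ω → ℝ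
  | 0 => U₀
  | k + 1 => fun ω => (U k ω : ℝ)

/-- The conditions on `U₀, U₁, U₂, …`: they are independent, `U₀` is uniform on `[0, 2π]`, and
`U₁, U₂, …` are uniform on `{0, …, p - 1}`. -/
structure IsUniformDigits (p : ℕ) (P : Measure Ω) (U₀ : Ω → ℝ) (U : ℕ → Ω → ℤ) : Prop where
  measurable_zero : Measurable U₀
  measurable_succ : ∀ k, Measurable (U k)
  indep : ProbabilityTheory.iIndepFun (realSeq U₀ U) P
  uniform_zero : pdf.IsUniform U₀ (Set.Icc 0 (2 * Real.pi)) P volume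
  uniform_succ : ∀ k, pdf.IsUniform (U k) (Set.Ico 0 (p : ℤ)) P Measure.count

end Random

end

/-! All identities of measures are proved through Fourier transforms: on a Polish group whose
characters separate points, a finite measure is determined by its integrals against characters
(`ext_of_fourierTransform`).

The bridge between the two groups is `solenoidChar_solenoidMap`: composed with `φ`, the character
`χ_{d,ℓ}` depends only on the first `d + 1` coordinates and is a character of `ℝ × ℤ^d` with real
frequency `ℓ / p^d`. As `φ ∘ τ = id`, the exponent of `π_{η,g}` at `χ_{d,ℓ}` equals the exponent of
the generalized Poisson measure of `levyImage p d η` at that character. So any `Y` with the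
prescribed finite-dimensional laws has `φ(Y)` distributed as `π_{η,g}` (`isGenPoissonMeasure_map`).
The Gauss measure is the image of a normal law under the one-parameter subgroup `t ↦ φ(t, 0)`, and
independence turns the product in the solenoid into a convolution.

The substantial point is the existence of one law on `ℝ × ℤ^∞` with these marginals
(`exists_joint_law`). Split `η` into countably many pieces of finite mass that approach the
identity, and take independent centred compound Poisson variables, one per piece. Near the identity
the first digits of `τ` vanish, so each integer coordinate of the sum has only finitely many nonzero
terms. The real coordinate converges almost surely by Borel–Cantelli, because the second moments of
the pieces can be made geometrically small.

For the Haar measure, a nontrivial character is `χ_{0,ℓ}` with `ℓ ≠ 0`, or `χ_{d+1,ℓ}` with `p ∤ ℓ`;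
its mean under `φ(U₀, U₁, …)` vanishes because of `U₀` or of the last digit involved, respectively.
-/

noncomputable section

/-! ### Uniqueness of measures with a given Fourier transform -/

section FourierUniqueness

variable {G : Type*} [CommGroup G] [TopologicalSpace G]

theorem continuous_char (χ : PontryaginDual G) : Continuous fun x => ((χ x : Circle) : ℂ) :=
  continuous_subtype_val.comp (map_continuous χ)

/-- A character as a bounded continuous function. -/
def charBCF (χ : PontryaginDual G) : BoundedContinuousFunction G ℂ :=
  BoundedContinuousFunction.ofNormedAddCommGroup (fun x => ((χ x : Circle) : ℂ))
    (continuous_char χ) 1 (fun _ => (Circle.norm_coe _).le)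

theorem charBCF_apply (χ : PontryaginDual G) (x : G) : charBCF χ x = ((χ x : Circle) : ℂ) := rfl

/-- Characters as a monoid homomorphism into the bounded continuous functions. -/
def charBCFHom : PontryaginDual G →* BoundedContinuousFunction G ℂ where
  toFun := charBCF
  map_one' := by ext x; simp [charBCF_apply]
  map_mul' χ₁ χ₂ := by
    ext x
    simp only [charBCF_apply, BoundedContinuousFunction.coe_mul, Pi.mul_apply]
    rw [← Circle.coe_mul]; rfl

/-- The trigonometric polynomials. -/
def trigPoly (G : Type*) [CommGroup G] [TopologicalSpace G] :
    StarSubalgebra ℂ (BoundedContinuousFunction G ℂ) where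
  toSubalgebra := Algebra.adjoin ℂ (MonoidHom.mrange (charBCFHom (G := G)) : Set _)
  star_mem' := by
    intro f hf
    induction hf using Algebra.adjoin_induction with
    | mem f hf =>
      obtain ⟨χ, rfl⟩ := hf
      refine Algebra.subset_adjoin ⟨χ⁻¹, ?_⟩
      ext x
      have h : (χ⁻¹) x = (χ x)⁻¹ := rfl
      simp only [charBCFHom, MonoidHom.coe_mk, OneHom.coe_mk, charBCF_apply,
        BoundedContinuousFunction.star_apply, h, Circle.coe_inv_eq_conj]
      rfl
    | algebraMap r =>
      have : star (algebraMap ℂ (BoundedContinuousFunction G ℂ) r) = algebraMap ℂ _ (star r) := by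
        ext x; simp
      rw [this]
      exact Subalgebra.algebraMap_mem _ _
    | add f g _ _ hf hg => rw [star_add]; exact Subalgebra.add_mem _ hf hg
    | mul f g _ _ hf hg => rw [star_mul]; exact Subalgebra.mul_mem _ hg hf

theorem charBCF_mem_trigPoly (χ : PontryaginDual G) : charBCF χ ∈ trigPoly G := by
  have h : charBCF χ ∈ Algebra.adjoin ℂ
      (MonoidHom.mrange (charBCFHom (G := G)) : Set (BoundedContinuousFunction G ℂ)) :=
    Algebra.subset_adjoin (SetLike.mem_coe.2 (MonoidHom.mem_mrange.2 ⟨χ, rfl⟩))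
  exact h

/-- Characters are closed under products, so the algebra they generate is already their linear span.
-/
theorem trigPoly_le_span {f : BoundedContinuousFunction G ℂ} (hf : f ∈ trigPoly G) :
    f ∈ Submodule.span ℂ (MonoidHom.mrange (charBCFHom (G := G)) : Set _) := by
  have hf' : f ∈ Subalgebra.toSubmodule
      (Algebra.adjoin ℂ (MonoidHom.mrange (charBCFHom (G := G)) : Set _)) := hf
  rwa [Algebra.adjoin_eq_span, Submonoid.closure_eq] at hf'

variable [MeasurableSpace G]

theorem integrable_char [BorelSpace G] (μ : Measure G) [IsFiniteMeasure μ]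
    (χ : PontryaginDual G) : Integrable (fun x => ((χ x : Circle) : ℂ)) μ :=
  Integrable.of_bound (continuous_char χ).measurable.aestronglyMeasurable 1
    (Filter.Eventually.of_forall fun _ => (Circle.norm_coe _).le)

/-- Trigonometric polynomials form a point-separating star algebra of bounded continuous functions,
which determines finite measures on a Polish space; by linearity only characters need to be tested.
-/
theorem ext_of_fourierTransform [PolishSpace G] [BorelSpace G]
    (hsep : ∀ x y : G, x ≠ y → ∃ χ : PontryaginDual G, χ x ≠ χ y)
    {μ ν : Measure G} [IsFiniteMeasure μ] [IsFiniteMeasure ν]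
    (h : ∀ χ, fourierTransform μ χ = fourierTransform ν χ) : μ = ν := by
  refine ext_of_forall_mem_subalgebra_integral_eq_of_polish (𝕜 := ℂ) (A := trigPoly G) ?_ ?_
  · intro x y hxy
    obtain ⟨χ, hχ⟩ := hsep x y hxy
    refine ⟨charBCF χ, ?_, fun h => hχ (Circle.coe_injective h)⟩
    simp only [StarSubalgebra.coe_toSubalgebra, StarSubalgebra.coe_map, Set.mem_image,
      SetLike.mem_coe, exists_exists_and_eq_and]
    exact ⟨charBCF χ, charBCF_mem_trigPoly χ, rfl⟩
  · intro f hf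
    replace hf := trigPoly_le_span hf
    induction hf using Submodule.span_induction with
    | mem f hf =>
      obtain ⟨χ, rfl⟩ := hf
      exact h χ
    | zero => simp
    | add f g _ _ hf hg =>
      simp only [BoundedContinuousFunction.coe_add, Pi.add_apply]
      rw [integral_add (f.integrable μ) (g.integrable μ),
        integral_add (f.integrable ν) (g.integrable ν), hf, hg]
    | smul c f _ hf =>
      simp only [BoundedContinuousFunction.coe_smul]
      rw [integral_smul, integral_smul, hf]

theorem fourierTransform_mconv [IsTopologicalGroup G] [SecondCountableTopology G] [BorelSpace G]
    (μ ν : Measure G) [IsFiniteMeasure μ] [IsFiniteMeasure ν] (χ : PontryaginDual G) :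
    fourierTransform (μ.mconv ν) χ = fourierTransform μ χ * fourierTransform ν χ := by
  unfold fourierTransform
  rw [integral_mconv (integrable_char _ χ)]
  simp only [map_mul, Circle.coe_mul, integral_const_mul, integral_mul_const]

theorem fourierTransform_dirac [BorelSpace G] [T2Space G] (a : G) (χ : PontryaginDual G) :
    fourierTransform (Measure.dirac a) χ = ((χ a : Circle) : ℂ) :=
  integral_dirac _ _

theorem fourierTransform_map [BorelSpace G] {Ω : Type*} [MeasurableSpace Ω] {P : Measure Ω}
    {f : Ω → G} (hf : Measurable f) (χ : PontryaginDual G) :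
    fourierTransform (P.map f) χ = ∫ ω, ((χ (f ω) : Circle) : ℂ) ∂P :=
  integral_map hf.aemeasurable (continuous_char χ).measurable.aestronglyMeasurable

theorem IsGenPoissonMeasure.unique [PolishSpace G] [BorelSpace G]
    (hsep : ∀ x y : G, x ≠ y → ∃ χ : PontryaginDual G, χ x ≠ χ y)
    {η : Measure G} {g : G → PontryaginDual G → ℝ} {μ ν : Measure G}
    (hμ : IsGenPoissonMeasure η g μ) (hν : IsGenPoissonMeasure η g ν) : μ = ν := by
  have := hμ.prob
  have := hν.prob
  exact ext_of_fourierTransform hsep fun χ => (hμ.fourier χ).trans (hν.fourier χ).symm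

theorem IsGaussMeasure.unique [PolishSpace G] [BorelSpace G]
    (hsep : ∀ x y : G, x ≠ y → ∃ χ : PontryaginDual G, χ x ≠ χ y)
    {ψ : PontryaginDual G → ℝ} {μ ν : Measure G}
    (hμ : IsGaussMeasure ψ μ) (hν : IsGaussMeasure ψ ν) : μ = ν := by
  have := hμ.prob
  have := hν.prob
  exact ext_of_fourierTransform hsep fun χ => (hμ.fourier χ).trans (hν.fourier χ).symm

end FourierUniqueness

/-! ### Characters of `ℝ` and of `ℝ × ℤ^n` -/

/-- Lift `f` through the covering `ℝ → 𝕋`. Uniqueness of lifts makes the lift additive, and a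
continuous additive function on `ℝ` is linear. -/
theorem exists_real_char_eq (f : ℝ → Circle) (hf : Continuous f)
    (hadd : ∀ x y, f (x + y) = f x * f y) : ∃ c : ℝ, ∀ x, f x = Circle.exp (c * x) := by
  have h0 : f 0 = 1 := by simpa using hadd 0 0
  obtain ⟨F, ⟨hF0, hF⟩, -⟩ := Circle.isCoveringMap_exp.existsUnique_continuousMap_lifts
    ⟨f, hf⟩ (0 : ℝ) 0 (by simp [h0])
  have hF' : ∀ x, Circle.exp (F x) = f x := fun x => congrFun hF x
  have hFadd : ∀ x y, F (x + y) = F x + F y := by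
    intro x y
    obtain ⟨_, -, huniq⟩ := Circle.isCoveringMap_exp.existsUnique_continuousMap_lifts
      ⟨f, hf⟩ (0 : ℝ) 0 (by simp [h0])
    -- For fixed `y`, the function `t ↦ F (t + y) - F y` is again a lift of `f` that vanishes at
    -- `0`.
    have h1 := huniq ⟨fun t => F (t + y) - F y, by fun_prop⟩ ⟨by simp, by
      funext t
      simp [Circle.exp_sub, hF', hadd]⟩
    have h2 := huniq F ⟨hF0, hF⟩
    have h3 := congrArg (fun g : C(ℝ, ℝ) => g x) (h1.trans h2.symm)
    simp only [ContinuousMap.coe_mk] at h3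
    linarith
  let L : ℝ →+ ℝ := ⟨⟨F, hF0⟩, hFadd⟩
  refine ⟨F 1, fun x => ?_⟩
  have h := (L.toRealLinearMap F.continuous).map_smul x 1
  have h' : F x = x * F 1 := by simpa [L] using h
  rw [← hF', h', mul_comm]

theorem exists_rzChar_eq (n : ℕ) (χ : PontryaginDual (RZ n)) : ∃ y z, χ = rzChar n y z := by
  have hc : Continuous fun t : ℝ => χ (Multiplicative.ofAdd (t, (0 : Fin n → ℤ))) :=
    (map_continuous χ).comp (continuous_ofAdd.comp (by fun_prop))
  obtain ⟨y, hy⟩ := exists_real_char_eq _ hc (by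
    intro s t
    rw [← map_mul, ← ofAdd_add]; simp)
  refine ⟨y, fun k => χ (Multiplicative.ofAdd (0, Pi.single k 1)), ?_⟩
  ext v
  have hv : v = Multiplicative.ofAdd ((Multiplicative.toAdd v).1, (0 : Fin n → ℤ)) *
      ∏ k, Multiplicative.ofAdd ((0 : ℝ), (Pi.single k 1 : Fin n → ℤ)) ^
        ((Multiplicative.toAdd v).2 k) := by
    apply Multiplicative.toAdd.injective
    simp only [toAdd_mul, toAdd_ofAdd, toAdd_prod, toAdd_zpow]
    ext
    · simp [Prod.fst_sum]
    · simp [Prod.snd_sum, Finset.sum_apply, Pi.single_apply]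
  conv_lhs => rw [hv]
  rw [map_mul, map_prod, rzChar_apply, hy]
  simp only [map_zpow]

theorem rz_separates (n : ℕ) (v w : RZ n) (h : v ≠ w) :
    ∃ χ : PontryaginDual (RZ n), χ v ≠ χ w := by
  by_contra! hχ
  apply h
  apply Multiplicative.toAdd.injective
  have h1 : (Multiplicative.toAdd v).1 = (Multiplicative.toAdd w).1 := by
    refine eq_of_exp_mul_eq fun t => ?_
    have := hχ (rzChar n t 1)
    simpa [rzChar_apply, mul_comm] using this
  refine Prod.ext h1 (funext fun k => ?_)
  have h2 : (((Multiplicative.toAdd v).2 k : ℤ) : ℝ) = ((Multiplicative.toAdd w).2 k : ℤ) := by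
    refine eq_of_exp_mul_eq fun t => ?_
    have := hχ (rzChar n 0 (Pi.mulSingle k (Circle.exp t)))
    rw [rzChar_apply, rzChar_apply, Finset.prod_eq_single k, Finset.prod_eq_single k] at this
    · simpa [← Circle.exp_intCast_mul] using this
    · intro j _ hj; simp [hj]
    · simp
    · intro j _ hj; simp [hj]
    · simp
  exact_mod_cast h2

instance RZ.polishSpace (n : ℕ) : PolishSpace (RZ n) :=
  inferInstanceAs (PolishSpace (ℝ × (Fin n → ℤ)))

/-! ### The solenoid -/

section Solenoid

variable (p : ℕ)

theorem solenoid_isClosed : IsClosed (solenoid p : Set (ℕ → Circle)) :=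
  (isCompact_iff_compactSpace.mpr (solenoid.compactSpace p)).isClosed

instance Circle.polishSpace : PolishSpace Circle :=
  inferInstanceAs (PolishSpace (Metric.sphere (0 : ℂ) 1))

instance solenoid.polishSpace (p : ℕ) : PolishSpace (solenoid p) :=
  (solenoid_isClosed p).polishSpace

theorem solenoidMap_coe [Fact p.Prime] (y : ℝ × (ℕ → ℤ)) (j : ℕ) :
    (solenoidMap p y).1 j =
      Circle.exp ((y.1 + ∑ k ∈ Finset.range j, 2 * Real.pi * (y.2 k : ℝ) * (p : ℝ) ^ k) /
        (p : ℝ) ^ j) := rfl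

theorem continuous_solenoidMap [Fact p.Prime] : Continuous (solenoidMap p) := by
  refine Continuous.subtype_mk (continuous_pi fun j => ?_) _
  refine Circle.exp.continuous.comp (Continuous.div_const ?_ _)
  refine continuous_fst.add (continuous_finsetSum _ fun k _ => ?_)
  refine (continuous_const.mul ?_).mul continuous_const
  exact (continuous_of_discreteTopology (f := fun m : ℤ => (m : ℝ))).comp
    ((continuous_apply k).comp continuous_snd)

theorem solenoidMap_add [Fact p.Prime] (u v : ℝ × (ℕ → ℤ)) :
    solenoidMap p (u + v) = solenoidMap p u * solenoidMap p v := by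
  apply Subtype.ext
  funext j
  simp only [solenoidMap_coe, Subgroup.coe_mul, Pi.mul_apply, ← Circle.exp_add, Prod.fst_add,
    Prod.snd_add, Pi.add_apply, Int.cast_add, mul_add, add_mul, Finset.sum_add_distrib]
  congr 1
  ring

/-- The digits telescope: the partial sum up to `j` is `p^j arg x_j`. Thus `τ` is a section of `φ`,
which gives surjectivity. -/
theorem solenoidMap_solenoidTau [hp : Fact p.Prime] (x : solenoid p) :
    solenoidMap p (solenoidTau p x) = x := by
  apply Subtype.ext
  funext j
  have hp0 : (p : ℝ) ≠ 0 := by exact_mod_cast hp.out.ne_zero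
  have h : (solenoidTau p x).1 + ∑ k ∈ Finset.range j,
      2 * Real.pi * ((solenoidTau p x).2 k : ℝ) * (p : ℝ) ^ k =
      (p : ℝ) ^ j * circleArg (x.1 j) := by
    induction j with
    | zero => simp [solenoidTau]
    | succ j ih =>
      rw [Finset.sum_range_succ, ← add_assoc, ih, solenoidTau_cast]
      have := Real.pi_ne_zero
      field_simp
      ring
  rw [solenoidMap_coe, h, mul_div_cancel_left₀ _ (pow_ne_zero _ hp0), exp_circleArg]

theorem solenoid_coe_eq_one {x : solenoid p} {d j : ℕ} (hj : j ≤ d) (h : x.1 d = 1) :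
    x.1 j = 1 := by
  induction d, hj using Nat.le_induction with
  | base => exact h
  | succ d _ ih => exact ih (by rw [x.2 d, h, one_pow])

/-- A neighbourhood restricts finitely many coordinates only, and the coordinate `d` determines all
earlier ones. Hence it contains a whole subgroup `{x | x_d = 1}`. -/
theorem solenoid_mem_nhds_one {s : Set (solenoid p)} (hs : s ∈ 𝓝 1) :
    ∃ d, ∀ x : solenoid p, x.1 d = 1 → x ∈ s := by
  rw [nhds_subtype, Filter.mem_comap] at hs
  obtain ⟨t, ht, hts⟩ := hs
  rw [nhds_pi, Filter.mem_pi] at ht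
  obtain ⟨I, hI, u, hu, hut⟩ := ht
  obtain ⟨d, hd⟩ := hI.bddAbove
  refine ⟨d, fun x hx => hts (hut fun i hi => ?_)⟩
  rw [solenoid_coe_eq_one p (hd hi) hx]
  exact mem_of_mem_nhds (hu i)

/-- The circle has no small subgroups, so `χ` is trivial on some subgroup `{x | x_d = 1}` and
factors through `x_d`. The one-parameter subgroup `t ↦ φ(t, 0)` attains every value of `x_d`, so `χ`
is determined by its restriction `t ↦ exp (ict)` to it. -/
theorem exists_solenoidChar_eq [hp : Fact p.Prime] (χ : PontryaginDual (solenoid p)) :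
    ∃ d ℓ, χ = solenoidChar p d ℓ := by
  have hp0 : (p : ℝ) ≠ 0 := by exact_mod_cast hp.out.ne_zero
  obtain ⟨d, hd⟩ := solenoid_mem_nhds_one p (s := χ ⁻¹' (Circle.centeredArc (Real.pi / 2))) (by
    refine (map_continuous χ).continuousAt.preimage_mem_nhds ?_
    rw [map_one]
    refine (Circle.isOpen_centeredArc _).mem_nhds ?_
    rw [Circle.mem_centeredArc (by linarith [Real.pi_pos])]
    simp [Real.pi_pos])
  have hker : ∀ x : solenoid p, x.1 d = 1 → χ x = 1 := by
    intro x hx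
    refine Circle.eq_one_of_forall_pow_mem_centeredArc_pi_div_two fun n _ => ?_
    have h := hd (x ^ n) (by simp [hx])
    simpa using h
  have hsub : ∀ s t : ℝ, solenoidMap p (s + t, 0) = solenoidMap p (s, 0) * solenoidMap p (t, 0) :=
    fun s t => by rw [← solenoidMap_add]; simp
  obtain ⟨c, hc⟩ := exists_real_char_eq (fun t => χ (solenoidMap p (t, 0)))
    ((map_continuous χ).comp ((continuous_solenoidMap p).comp (by fun_prop)))
    (fun s t => by rw [hsub, map_mul])
  have hmap : ∀ t : ℝ, (solenoidMap p (t, 0)).1 d = Circle.exp (t / p ^ d) := by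
    intro t; rw [solenoidMap_coe]; simp
  -- At time `2π p^d` the coordinate `d` is back at `1`; this forces `c p^d` to be an integer.
  have h1 : Circle.exp (c * (2 * Real.pi * p ^ d)) = 1 := by
    rw [← hc]
    apply hker
    rw [hmap, mul_div_cancel_right₀ _ (pow_ne_zero _ hp0), Circle.exp_two_pi]
  obtain ⟨ℓ, hℓ⟩ := (Circle.exp_eq_one).1 h1
  have hcℓ : c = ℓ / p ^ d := by
    have := Real.pi_ne_zero
    field_simp
    have h2 : 2 * Real.pi * (c * p ^ d) = 2 * Real.pi * ℓ := by linarith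
    exact mul_left_cancel₀ (by positivity) h2
  refine ⟨d, ℓ, ?_⟩
  ext x
  set s : ℝ := circleArg (x.1 d) * p ^ d with hs
  have hxs : (solenoidMap p (s, 0)).1 d = x.1 d := by
    rw [hmap, hs, mul_div_cancel_right₀ _ (pow_ne_zero _ hp0), exp_circleArg]
  have hx : χ x = χ (solenoidMap p (s, 0)) := by
    have := hker (x * (solenoidMap p (s, 0))⁻¹) (by simp [hxs])
    rwa [map_mul, map_inv, mul_inv_eq_one] at this
  rw [hx, hc, solenoidChar_apply, ← hxs, hmap, ← Circle.exp_intCast_mul, hcℓ]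
  congr 2
  ring

theorem solenoid_separates (x y : solenoid p) (h : x ≠ y) :
    ∃ χ : PontryaginDual (solenoid p), χ x ≠ χ y := by
  by_contra! hχ
  refine h (Subtype.ext (funext fun d => ?_))
  simpa [solenoidChar_apply] using hχ (solenoidChar p d 1)

theorem solenoidChar_solenoidMap [Fact p.Prime] (d : ℕ) (ℓ : ℤ) (y : ℝ × (ℕ → ℤ)) :
    solenoidChar p d ℓ (solenoidMap p y) = rzChar d (ℓ / p ^ d)
      (fun k => Circle.exp (ℓ / p ^ d * (2 * Real.pi * p ^ (k : ℕ)))) (firstCoords d y) := by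
  rw [solenoidChar_apply, solenoidMap_coe, rzChar_apply, ← Circle.exp_intCast_mul]
  simp only [firstCoords, toAdd_ofAdd, ← Circle.exp_intCast_mul]
  have : ∀ s : Finset (Fin d), ∀ f : Fin d → ℝ, ∏ k ∈ s, Circle.exp (f k) =
      Circle.exp (∑ k ∈ s, f k) := by
    intro s f
    induction s using Finset.cons_induction with
    | empty => simp
    | cons a s ha ih => rw [Finset.prod_cons, Finset.sum_cons, Circle.exp_add, ih]
  rw [this, ← Circle.exp_add, Finset.sum_range]
  congr 1
  rw [mul_div_assoc', mul_add, Finset.mul_sum, add_div, Finset.sum_div]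
  congr 1
  · ring
  · exact Finset.sum_congr rfl fun k _ => by ring

/-- The frequency can be read off along `t ↦ φ(t, 0)`, where multiplying characters adds exponents.
-/
theorem solenoidFreq_mul [Fact p.Prime] (χ₁ χ₂ : PontryaginDual (solenoid p)) :
    solenoidFreq p (χ₁ * χ₂) = solenoidFreq p χ₁ + solenoidFreq p χ₂ := by
  obtain ⟨d, ℓ, rfl⟩ := exists_solenoidChar_eq p χ₁
  obtain ⟨e, m, rfl⟩ := exists_solenoidChar_eq p χ₂
  obtain ⟨f, k, h⟩ := exists_solenoidChar_eq p (solenoidChar p d ℓ * solenoidChar p e m)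
  rw [h]
  simp only [solenoidFreq_solenoidChar]
  refine eq_of_exp_mul_eq fun t => ?_
  have h1 := congrArg (fun χ : PontryaginDual (solenoid p) => χ (solenoidMap p (t, 0))) h
  have h2 : (solenoidChar p d ℓ * solenoidChar p e m) (solenoidMap p (t, 0)) =
      solenoidChar p d ℓ (solenoidMap p (t, 0)) * solenoidChar p e m (solenoidMap p (t, 0)) := rfl
  simp only [h2, solenoidChar_solenoidMap, rzChar_apply, firstCoords, toAdd_ofAdd, Pi.zero_apply,
    zpow_zero, Finset.prod_const_one, mul_one] at h1
  rw [← h1, add_mul, Circle.exp_add]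

theorem isQuadraticForm_solenoidForm [Fact p.Prime] (b : ℝ≥0) :
    IsQuadraticForm (solenoidForm p b) where
  nonneg χ := mul_nonneg b.2 (sq_nonneg _)
  -- The dual of a compact group is discrete.
  continuous := continuous_of_discreteTopology
  parallelogram χ₁ χ₂ := by
    have hinv : solenoidFreq p χ₂⁻¹ = -solenoidFreq p χ₂ := by
      have h1 : solenoidFreq p (1 : PontryaginDual (solenoid p)) = 0 := by
        have := solenoidFreq_mul p 1 1
        rw [mul_one] at this
        linarith
      have := solenoidFreq_mul p χ₂ χ₂⁻¹
      rw [mul_inv_cancel, h1] at this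
      linarith
    simp only [solenoidForm, solenoidFreq_mul, hinv]
    ring

end Solenoid

/-! ### Compound Poisson measures -/

section CompoundPoisson

variable {M : Type*} [AddMonoid M] [MeasurableSpace M]

/-- The convolution powers of a measure. -/
def convPow (ν : Measure M) : ℕ → Measure M
  | 0 => Measure.dirac 0
  | k + 1 => (convPow ν k).conv ν

/-- The compound Poisson measure `e^{-‖ν‖} ∑ ν^{*k} / k!` of a finite measure `ν`. -/
def compoundPoisson (ν : Measure M) : Measure M :=
  Measure.sum fun k =>
    ENNReal.ofReal (Real.exp (-ν.real Set.univ) / (k.factorial : ℝ)) • convPow ν k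

variable [MeasurableAdd₂ M] (ν : Measure M) [IsFiniteMeasure ν]

instance isFiniteMeasure_convPow (k : ℕ) : IsFiniteMeasure (convPow ν k) := by
  induction k with
  | zero => exact inferInstanceAs (IsFiniteMeasure (Measure.dirac 0))
  | succ k ih => exact inferInstanceAs (IsFiniteMeasure ((convPow ν k).conv ν))

theorem convPow_univ (k : ℕ) : convPow ν k Set.univ = ν Set.univ ^ k := by
  induction k with
  | zero => simp [convPow]
  | succ k ih =>
    rw [convPow, Measure.conv, Measure.map_apply measurable_add MeasurableSet.univ,
      Set.preimage_univ, ← Set.univ_prod_univ, Measure.prod_prod, ih, pow_succ]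

instance isProbabilityMeasure_compoundPoisson : IsProbabilityMeasure (compoundPoisson ν) := by
  constructor
  rw [compoundPoisson, Measure.sum_apply _ MeasurableSet.univ]
  have h : ∀ k : ℕ, (ENNReal.ofReal (Real.exp (-ν.real Set.univ) / (k.factorial : ℝ)) •
      convPow ν k) Set.univ =
      ENNReal.ofReal (Real.exp (-ν.real Set.univ) * (ν.real Set.univ ^ k / (k.factorial : ℝ))) := by
    intro k
    rw [Measure.smul_apply, convPow_univ, smul_eq_mul, ← ofReal_measureReal,
      ← ENNReal.ofReal_pow measureReal_nonneg, ← ENNReal.ofReal_mul (by positivity)]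
    congr 1
    ring
  simp_rw [h]
  have hs := (NormedSpace.expSeries_div_hasSum_exp (ν.real Set.univ)).mul_left
    (Real.exp (-ν.real Set.univ))
  rw [← ENNReal.ofReal_tsum_of_nonneg (fun k => by positivity) hs.summable, hs.tsum_eq,
    ← Real.exp_eq_exp_ℝ, ← Real.exp_add]
  simp

variable {ν}

theorem integral_convPow {f : M → ℂ} (hf : Measurable f) (hb : ∀ x, ‖f x‖ ≤ 1) (h0 : f 0 = 1)
    (hadd : ∀ x y, f (x + y) = f x * f y) (k : ℕ) :
    ∫ x, f x ∂(convPow ν k) = (∫ x, f x ∂ν) ^ k := by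
  induction k with
  | zero => simp [convPow, integral_dirac' f 0 hf.stronglyMeasurable, h0]
  | succ k ih =>
    rw [convPow, integral_conv (Integrable.of_bound hf.aestronglyMeasurable 1
      (Filter.Eventually.of_forall hb))]
    simp only [hadd, integral_const_mul, integral_mul_const, ih, pow_succ]

/-- The Fourier transform of a compound Poisson measure. -/
theorem integral_compoundPoisson {f : M → ℂ} (hf : Measurable f) (hb : ∀ x, ‖f x‖ ≤ 1)
    (h0 : f 0 = 1) (hadd : ∀ x y, f (x + y) = f x * f y) :
    ∫ x, f x ∂(compoundPoisson ν) = Complex.exp (∫ x, (f x - 1) ∂ν) := by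
  have hi : ∀ μ : Measure M, IsFiniteMeasure μ → Integrable f μ := fun μ _ =>
    Integrable.of_bound hf.aestronglyMeasurable 1 (Filter.Eventually.of_forall hb)
  have hs := hasSum_integral_measure (hi (compoundPoisson ν) inferInstance)
  have h : ∀ k : ℕ, ∫ x, f x ∂(ENNReal.ofReal (Real.exp (-ν.real Set.univ) / (k.factorial : ℝ)) •
      convPow ν k) =
      Complex.exp (-ν.real Set.univ) * ((∫ x, f x ∂ν) ^ k / (k.factorial : ℂ)) := by
    intro k
    rw [integral_smul_measure, integral_convPow hf hb h0 hadd,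
      ENNReal.toReal_ofReal (by positivity), Complex.real_smul]
    push_cast
    ring
  simp_rw [h] at hs
  have hs' := (NormedSpace.expSeries_div_hasSum_exp (∫ x, f x ∂ν)).mul_left
    (Complex.exp (-ν.real Set.univ))
  have := hs.unique hs'
  rw [← Complex.exp_eq_exp_ℂ, ← Complex.exp_add] at this
  refine this.trans ?_
  rw [integral_sub (hi ν inferInstance) (integrable_const 1)]
  congr 1
  simp
  ring

end CompoundPoisson

/-! ### Measurable submonoids that carry a compound Poisson measure -/

section AlmostEverywhere

variable {M : Type*} [AddMonoid M] [MeasurableSpace M] [MeasurableAdd₂ M] {ν : Measure M}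

theorem ae_convPow {S : Set M} (hS : MeasurableSet S) (h0 : (0 : M) ∈ S)
    (hadd : ∀ x ∈ S, ∀ y ∈ S, x + y ∈ S) (h : ∀ᵐ x ∂ν, x ∈ S) (k : ℕ) :
    ∀ᵐ x ∂(convPow ν k), x ∈ S := by
  induction k with
  | zero => exact (ae_dirac_iff (p := fun x => x ∈ S) hS).2 h0
  | succ k ih =>
    refine (ae_map_iff (p := fun x => x ∈ S) measurable_add.aemeasurable hS).2 ?_
    filter_upwards [Measure.quasiMeasurePreserving_fst.ae ih,
      Measure.quasiMeasurePreserving_snd.ae h] with z h1 h2 using hadd _ h1 _ h2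

theorem ae_compoundPoisson {S : Set M} (hS : MeasurableSet S) (h0 : (0 : M) ∈ S)
    (hadd : ∀ x ∈ S, ∀ y ∈ S, x + y ∈ S) (h : ∀ᵐ x ∂ν, x ∈ S) :
    ∀ᵐ x ∂(compoundPoisson ν), x ∈ S := by
  rw [compoundPoisson, Measure.ae_sum_iff]
  exact fun k => Measure.ae_smul_measure (ae_convPow hS h0 hadd h k) _

end AlmostEverywhere

/-! ### Lévy measures on the solenoid -/

/-- For `|x| ≤ 1` this is the Taylor remainder; otherwise the norm is at most `2 + |x| ≤ 3x²`. -/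
theorem norm_exp_mul_I_sub_one_sub_le (x : ℝ) :
    ‖Complex.exp (Complex.I * x) - 1 - Complex.I * x‖ ≤ 3 * x ^ 2 := by
  have hn : ‖Complex.I * (x : ℂ)‖ = |x| := by simp
  rcases le_or_gt |x| 1 with h | h
  · have := Complex.norm_exp_sub_one_sub_id_le (x := Complex.I * x) (by rwa [hn])
    rw [hn, sq_abs] at this
    nlinarith [sq_nonneg x]
  · have h1 := norm_sub_le (Complex.exp (Complex.I * x) - 1) (Complex.I * x)
    have h2 := norm_sub_le (Complex.exp (Complex.I * x)) 1
    rw [Complex.norm_exp_I_mul_ofReal, norm_one] at h2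
    rw [hn] at h1
    nlinarith [sq_abs x]

theorem measurable_truncFun : Measurable truncFun := by
  unfold truncFun
  refine Measurable.ite ?_ measurable_const (Measurable.ite ?_ (by fun_prop)
    (Measurable.ite ?_ (by fun_prop) (by fun_prop)))
  · exact (measurableSet_Iio).union measurableSet_Ici
  · exact measurableSet_Iio
  · exact measurableSet_Iio

theorem abs_truncFun_le (x : ℝ) : |truncFun x| ≤ Real.pi := by
  have := Real.pi_pos
  unfold truncFun
  split_ifs with h1 h2 h3 <;> rw [abs_le] <;> (try push Not at *) <;> constructor <;> linarith [h1]

theorem truncFun_eq_self {x : ℝ} (h : |x| ≤ 1) : truncFun x = x := by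
  have := Real.pi_gt_three
  obtain ⟨h1, h2⟩ := abs_le.1 h
  unfold truncFun
  rw [if_neg (by push Not; constructor <;> linarith), if_neg (by linarith), if_pos (by linarith)]

theorem abs_circleArg_le (z : Circle) : |circleArg z| ≤ Real.pi := by
  obtain ⟨h1, h2⟩ := circleArg_mem z
  exact abs_le.2 ⟨h1, h2.le⟩

theorem circleArg_one : circleArg 1 = 0 := by
  simp [circleArg, Real.pi_ne_zero.symm]

theorem continuousAt_circleArg_one : ContinuousAt circleArg 1 := by
  have h : ContinuousAt (fun z : Circle => Complex.arg (z : ℂ)) 1 :=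
    ContinuousAt.comp (g := Complex.arg) (Complex.continuousAt_arg (by simp))
      continuous_subtype_val.continuousAt
  refine h.congr ?_
  have h2 : ∀ᶠ z : Circle in 𝓝 1, Complex.arg (z : ℂ) < Real.pi :=
    h.eventually_lt continuousAt_const (by simp [Real.pi_pos])
  filter_upwards [h2] with z hz
  rw [circleArg, if_neg hz.ne]

/-! ### Neighbourhoods of the identity on which the first digits of `τ` vanish -/

section Near

variable (p : ℕ)

/-- Neighbourhoods of the identity of the solenoid on which the first coordinates have small
argument. -/
def nearOne (n : ℕ) : Set (solenoid p) :=
  {x | ∀ j ≤ n, (p : ℝ) * |circleArg (x.1 j)| < 1 / ((n : ℝ) + 1)}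

theorem measurableSet_nearOne (n : ℕ) : MeasurableSet (nearOne p n) := by
  have : nearOne p n = ⋂ j, ⋂ (_ : j ≤ n),
      {x | (p : ℝ) * |circleArg (x.1 j)| < 1 / ((n : ℝ) + 1)} := by
    ext x; simp [nearOne]
  rw [this]
  refine MeasurableSet.iInter fun j => MeasurableSet.iInter fun _ => ?_
  exact measurableSet_lt ((measurable_circleArg_coord p j).abs.const_mul _) measurable_const

theorem nearOne_mem_nhds (n : ℕ) : nearOne p n ∈ 𝓝 (1 : solenoid p) := by
  have : nearOne p n = ⋂ j ∈ Finset.range (n + 1),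
      {x | (p : ℝ) * |circleArg (x.1 j)| < 1 / ((n : ℝ) + 1)} := by
    ext x; simp [nearOne]
  rw [this, Filter.biInter_finset_mem]
  intro j _
  have hc : ContinuousAt (fun x : solenoid p => circleArg (x.1 j)) 1 :=
    ContinuousAt.comp (g := circleArg) (f := fun x : solenoid p => x.1 j)
      continuousAt_circleArg_one ((continuous_apply j).comp continuous_subtype_val).continuousAt
  refine (hc.abs.const_mul (p : ℝ)).eventually_lt continuousAt_const ?_
  have : circleArg ((1 : solenoid p).1 j) = 0 := circleArg_one
  rw [this]
  simp only [abs_zero, mul_zero]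
  positivity

theorem nearOne_antitone : Antitone (nearOne p) := by
  intro m n hmn x hx j hj
  refine (hx j (hj.trans hmn)).trans_le ?_
  gcongr

theorem abs_circleArg_lt_of_mem_nearOne [hp : Fact p.Prime] {n j : ℕ} (hj : j ≤ n)
    {x : solenoid p} (hx : x ∈ nearOne p n) : |circleArg (x.1 j)| < 1 / ((n : ℝ) + 1) := by
  have h1 : (1 : ℝ) ≤ p := by exact_mod_cast hp.out.one_lt.le
  have := hx j hj
  nlinarith [abs_nonneg (circleArg (x.1 j))]

theorem iInter_nearOne [Fact p.Prime] : ⋂ n, nearOne p n = {1} := by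
  ext x
  simp only [Set.mem_iInter, Set.mem_singleton_iff]
  constructor
  · intro h
    apply Subtype.ext
    funext j
    have h0 : |circleArg (x.1 j)| ≤ 0 := by
      refine ge_of_tendsto (tendsto_one_div_add_atTop_nhds_zero_nat (𝕜 := ℝ)) ?_
      filter_upwards [Filter.eventually_ge_atTop j] with n hn
      exact (abs_circleArg_lt_of_mem_nearOne p hn (h n)).le
    have h1 : circleArg (x.1 j) = 0 := abs_nonpos_iff.1 h0
    rw [← exp_circleArg (x.1 j), h1, Circle.exp_zero]
    rfl
  · rintro rfl n
    exact mem_of_mem_nhds (nearOne_mem_nhds p n)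

theorem abs_tau_fst_le_one [Fact p.Prime] {n : ℕ} {x : solenoid p} (hx : x ∈ nearOne p n) :
    |(solenoidTau p x).1| ≤ 1 := by
  refine (abs_circleArg_lt_of_mem_nearOne p (Nat.zero_le n) hx).le.trans ?_
  rw [div_le_one (by positivity)]
  linarith [(Nat.cast_nonneg n : (0 : ℝ) ≤ n)]

/-- The digit is an integer equal to `(p arg x_{k+1} - arg x_k) / 2π`, and on `nearOne p n` the
numerator is smaller than `2`. This is the purpose of the factor `p` in `nearOne`. -/
theorem tau_snd_eq_zero [Fact p.Prime] {n k : ℕ} (hk : k < n) {x : solenoid p}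
    (hx : x ∈ nearOne p n) : (solenoidTau p x).2 k = 0 := by
  have h1 := hx (k + 1) hk
  have h2 := abs_circleArg_lt_of_mem_nearOne p hk.le hx
  have h3 : (1 : ℝ) / (n + 1) ≤ 1 := by
    rw [div_le_one (by positivity)]
    linarith [(Nat.cast_nonneg n : (0 : ℝ) ≤ n)]
  have hpi := Real.pi_gt_three
  have h4 : |(((solenoidTau p x).2 k : ℤ) : ℝ)| < 1 := by
    rw [solenoidTau_cast, abs_div, abs_of_pos (by linarith : 0 < 2 * Real.pi),
      div_lt_one (by linarith)]
    refine (abs_sub _ _).trans_lt ?_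
    rw [abs_mul, Nat.abs_cast]
    linarith
  have h5 : |(solenoidTau p x).2 k| < 1 := by exact_mod_cast h4
  exact Int.abs_lt_one_iff.1 h5

theorem measurable_solenoidTau : Measurable (solenoidTau p) := by
  refine Measurable.prodMk (measurable_circleArg_coord p 0) (measurable_pi_lambda _ fun k => ?_)
  exact ((((measurable_circleArg_coord p (k + 1)).const_mul _).sub
    (measurable_circleArg_coord p k)).div_const _).floor

end Near

/-! ### Second moment, convergence of the exponents, and the images `η_{n+1}` -/

section Levy

variable {p : ℕ} {η : Measure (solenoid p)}

theorem IsLevyMeasure.compl_nearOne (hη : IsLevyMeasure η) (n : ℕ) : η (nearOne p n)ᶜ < ∞ :=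
  hη.compl_nhds _ (measurableSet_nearOne p n) (nearOne_mem_nhds p n)

/-- The inequality `cos t ≤ 1 - 2t²/π²` on `[-π, π]` bounds `(arg x₀)²` by a multiple of `1 - Re
χ_{0,1}`, so the Lévy condition for one character suffices. -/
theorem IsLevyMeasure.lintegral_sq (hη : IsLevyMeasure η) :
    ∫⁻ x, ENNReal.ofReal ((solenoidTau p x).1 ^ 2) ∂η < ∞ := by
  have h := hη.char (solenoidChar p 0 1)
  have hpi := Real.pi_pos
  calc ∫⁻ x, ENNReal.ofReal ((solenoidTau p x).1 ^ 2) ∂η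
      ≤ ∫⁻ x, ENNReal.ofReal (Real.pi ^ 2 / 2) *
        ENNReal.ofReal (1 - ((solenoidChar p 0 1 x : Circle) : ℂ).re) ∂η := by
        refine lintegral_mono fun x => ?_
        rw [← ENNReal.ofReal_mul (by positivity)]
        refine ENNReal.ofReal_le_ofReal ?_
        have hre : ((solenoidChar p 0 1 x : Circle) : ℂ).re = Real.cos (circleArg (x.1 0)) := by
          rw [solenoidChar_apply, zpow_one]
          conv_lhs => rw [← exp_circleArg (x.1 0)]
          rw [Circle.coe_exp, Complex.exp_ofReal_mul_I_re]
        rw [hre]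
        have hc := Real.cos_le_one_sub_mul_cos_sq (abs_circleArg_le (x.1 0))
        change circleArg (x.1 0) ^ 2 ≤ _
        calc circleArg (x.1 0) ^ 2
            = Real.pi ^ 2 / 2 * (2 / Real.pi ^ 2 * circleArg (x.1 0) ^ 2) := by
              field_simp
          _ ≤ _ := by gcongr; linarith
    _ = ENNReal.ofReal (Real.pi ^ 2 / 2) *
        ∫⁻ x, ENNReal.ofReal (1 - ((solenoidChar p 0 1 x : Circle) : ℂ).re) ∂η :=
        lintegral_const_mul' _ _ ENNReal.ofReal_ne_top
    _ < ∞ := ENNReal.mul_lt_top ENNReal.ofReal_lt_top h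

/-- The integrand in the Lévy–Khinchin exponent of `levyImage p n η`, pulled back to the
solenoid. -/
def levyIntegrand (p n : ℕ) (y : ℝ) (z : Fin n → Circle) (x : solenoid p) : ℂ :=
  ((rzChar n y z (firstCoords n (solenoidTau p x)) : Circle) : ℂ) - 1 -
    Complex.I * ((y * truncFun (solenoidTau p x).1 : ℝ) : ℂ)

theorem measurable_levyIntegrand (n : ℕ) (y : ℝ) (z : Fin n → Circle) :
    Measurable (levyIntegrand p n y z) := by
  have h1 : Measurable fun x : solenoid p =>
      ((rzChar n y z (firstCoords n (solenoidTau p x)) : Circle) : ℂ) :=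
    (continuous_char (rzChar n y z)).measurable.comp (measurable_firstCoords_tau p n)
  have h2 : Measurable fun x : solenoid p => truncFun (solenoidTau p x).1 :=
    measurable_truncFun.comp (measurable_solenoidTau p).fst
  unfold levyIntegrand
  exact (h1.sub_const 1).sub
    ((Complex.measurable_ofReal.comp (h2.const_mul y)).const_mul Complex.I)

/-- Close to the identity the digits are `0` and `h` is the identity, so the integrand is the
compensated exponential on the line, of size `O((arg x₀)²)`. -/
theorem levyIntegrand_eq [Fact p.Prime] {n m : ℕ} (hnm : n ≤ m) (y : ℝ) (z : Fin n → Circle)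
    {x : solenoid p} (hx : x ∈ nearOne p m) : levyIntegrand p n y z x =
      Complex.exp (Complex.I * ((y * (solenoidTau p x).1 : ℝ) : ℂ)) - 1 -
        Complex.I * ((y * (solenoidTau p x).1 : ℝ) : ℂ) := by
  have h : rzChar n y z (firstCoords n (solenoidTau p x)) =
      Circle.exp (y * (solenoidTau p x).1) := by
    rw [rzChar_apply, Finset.prod_eq_one, mul_one]
    · rfl
    · intro k _
      have : (Multiplicative.toAdd (firstCoords n (solenoidTau p x))).2 k = 0 :=
        tau_snd_eq_zero p (k.2.trans_le hnm) hx
      rw [this, zpow_zero]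
  rw [levyIntegrand, h, truncFun_eq_self (abs_tau_fst_le_one p hx), Circle.coe_exp,
    mul_comm Complex.I]

theorem integrable_tau_sq (hη : IsLevyMeasure η) :
    Integrable (fun x => (solenoidTau p x).1 ^ 2) η := by
  refine ⟨((measurable_solenoidTau p).fst.pow_const 2).aestronglyMeasurable, ?_⟩
  rw [hasFiniteIntegral_iff_ofReal (Filter.Eventually.of_forall fun x => sq_nonneg _)]
  exact hη.lintegral_sq

/-- On `nearOne p n` the integrand is dominated by the integrable second moment; on the complement
it is bounded and the mass is finite. -/
theorem integrable_levyIntegrand [Fact p.Prime] (hη : IsLevyMeasure η) (n : ℕ) (y : ℝ)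
    (z : Fin n → Circle) : Integrable (levyIntegrand p n y z) η := by
  have hm := (measurable_levyIntegrand (p := p) n y z).aestronglyMeasurable (μ := η)
  have h1 : IntegrableOn (levyIntegrand p n y z) (nearOne p n) η := by
    refine Integrable.mono' (((integrable_tau_sq hη).const_mul (3 * y ^ 2)).integrableOn)
      hm.restrict ?_
    filter_upwards [ae_restrict_mem (measurableSet_nearOne p n)] with x hx
    rw [levyIntegrand_eq le_rfl y z hx]
    refine (norm_exp_mul_I_sub_one_sub_le _).trans (le_of_eq ?_)
    ring
  have h2 : IntegrableOn (levyIntegrand p n y z) (nearOne p n)ᶜ η := by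
    have : IsFiniteMeasure (η.restrict (nearOne p n)ᶜ) :=
      isFiniteMeasure_restrict.2 (hη.compl_nearOne n).ne
    refine Integrable.of_bound hm.restrict (2 + |y| * Real.pi)
      (Filter.Eventually.of_forall fun x => ?_)
    refine (norm_sub_le _ _).trans (add_le_add ((norm_sub_le _ _).trans ?_) ?_)
    · rw [Circle.norm_coe, norm_one]; norm_num
    · rw [norm_mul, Complex.norm_I, one_mul, Complex.norm_real, Real.norm_eq_abs, abs_mul]
      exact mul_le_mul_of_nonneg_left (abs_truncFun_le _) (abs_nonneg y)
  rw [← integrableOn_univ, ← Set.union_compl_self (nearOne p n)]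
  exact h1.union h2

/-- The integrand in the exponent of a generalized Poisson measure on `ℝ × ℤ^n`. -/
def rzIntegrand (n : ℕ) (y : ℝ) (z : Fin n → Circle) (v : RZ n) : ℂ :=
  ((rzChar n y z v : Circle) : ℂ) - 1 - Complex.I * ((rzInner n v (rzChar n y z) : ℝ) : ℂ)

theorem rzIntegrand_comp (n : ℕ) (y : ℝ) (z : Fin n → Circle) (x : solenoid p) :
    rzIntegrand n y z (firstCoords n (solenoidTau p x)) = levyIntegrand p n y z x := by
  simp only [rzIntegrand, levyIntegrand, rzInner, rzFreq_rzChar]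
  rfl

theorem measurable_rzIntegrand (n : ℕ) (y : ℝ) (z : Fin n → Circle) :
    Measurable (rzIntegrand n y z) := by
  have h2 : Measurable fun v : RZ n => truncFun (Multiplicative.toAdd v).1 :=
    measurable_truncFun.comp (measurable_fst (α := ℝ) (β := Fin n → ℤ))
  unfold rzIntegrand
  simp only [rzInner]
  exact ((continuous_char (rzChar n y z)).measurable.sub_const 1).sub
    ((Complex.measurable_ofReal.comp (h2.const_mul _)).const_mul Complex.I)

theorem rzIntegrand_one (n : ℕ) (y : ℝ) (z : Fin n → Circle) : rzIntegrand n y z 1 = 0 := by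
  have : truncFun 0 = 0 := truncFun_eq_self (by simp)
  simp [rzIntegrand, rzInner, this]

/-- Since the integrand vanishes at the identity, the mass that `levyImage` removes there, possibly
infinite, does not affect the exponent. -/
theorem indicator_rzIntegrand (n : ℕ) (y : ℝ) (z : Fin n → Circle) :
    ({1}ᶜ : Set (RZ n)).indicator (rzIntegrand n y z) = rzIntegrand n y z := by
  rw [Set.indicator_eq_self]
  intro v hv h
  rw [Set.mem_singleton_iff.1 h] at hv
  exact hv (rzIntegrand_one n y z)

theorem integrable_rzIntegrand [Fact p.Prime] (hη : IsLevyMeasure η) (n : ℕ) (y : ℝ)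
    (z : Fin n → Circle) : Integrable (rzIntegrand n y z) (levyImage p n η) := by
  have hm := measurable_rzIntegrand n y z
  refine Integrable.integrableOn ?_
  rw [integrable_map_measure hm.aestronglyMeasurable (measurable_firstCoords_tau p n).aemeasurable]
  exact (integrable_levyIntegrand hη n y z).congr
    (Filter.Eventually.of_forall fun x => (rzIntegrand_comp n y z x).symm)

theorem integral_rzIntegrand (n : ℕ) (y : ℝ) (z : Fin n → Circle) :
    ∫ v, rzIntegrand n y z v ∂(levyImage p n η) = ∫ x, levyIntegrand p n y z x ∂η := by
  rw [levyImage, ← integral_indicator (measurableSet_singleton _).compl, indicator_rzIntegrand,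
    integral_map (measurable_firstCoords_tau p n).aemeasurable
      (measurable_rzIntegrand n y z).aestronglyMeasurable]
  exact integral_congr_ae (Filter.Eventually.of_forall fun x => rzIntegrand_comp n y z x)

theorem isLevyMeasure_levyImage [Fact p.Prime] (hη : IsLevyMeasure η) (n : ℕ) :
    IsLevyMeasure (levyImage p n η) where
  one := levyImage_one p n η
  compl_nhds U hU hU1 := by
    refine (Measure.restrict_apply_le _ _).trans_lt ?_
    rw [Measure.map_apply (measurable_firstCoords_tau p n) hU.compl]
    refine hη.compl_nhds ((fun x => firstCoords n (solenoidTau p x)) ⁻¹' U)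
      (measurable_firstCoords_tau p n hU) ?_
    have hU0 : (Multiplicative.ofAdd ⁻¹' U : Set (ℝ × (Fin n → ℤ))) ∈ 𝓝 0 := hU1
    have hc : ContinuousAt (fun x : solenoid p => circleArg (x.1 0)) 1 :=
      ContinuousAt.comp (g := circleArg) (f := fun x : solenoid p => x.1 0)
        continuousAt_circleArg_one ((continuous_apply 0).comp continuous_subtype_val).continuousAt
    have hc' : ContinuousAt (fun x : solenoid p => (circleArg (x.1 0), (0 : Fin n → ℤ))) 1 :=
      hc.prodMk continuousAt_const
    have h1 : (circleArg ((1 : solenoid p).1 0), (0 : Fin n → ℤ)) = 0 := by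
      have : circleArg ((1 : solenoid p).1 0) = 0 := circleArg_one
      rw [this]; rfl
    rw [ContinuousAt, h1] at hc'
    -- `τ` is not continuous, but on `nearOne p n` its first `n` digits are `0`, so only the
    -- continuity of `arg` at `1` matters.
    filter_upwards [nearOne_mem_nhds p n, hc' hU0] with x hx hxU
    have : firstCoords n (solenoidTau p x) = Multiplicative.ofAdd (circleArg (x.1 0), 0) := by
      refine congrArg Multiplicative.ofAdd (Prod.ext rfl (funext fun k => ?_))
      exact tau_snd_eq_zero p k.2 hx
    rw [Set.mem_preimage, this]
    exact hxU
  char χ := by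
    obtain ⟨y, z, rfl⟩ := exists_rzChar_eq n χ
    -- The compensator is purely imaginary: minus the real part of the integrand is exactly `1 - Re
    -- χ`.
    have h := (integrable_rzIntegrand hη n y z).re.neg
    have h2 : ∀ v, (-fun v => RCLike.re (rzIntegrand n y z v)) v =
        1 - ((rzChar n y z v : Circle) : ℂ).re := by
      intro v
      simp [rzIntegrand]
    have h3 : Integrable (fun v => 1 - ((rzChar n y z v : Circle) : ℂ).re) (levyImage p n η) :=
      h.congr (Filter.Eventually.of_forall h2)
    have h4 := h3.2
    rwa [hasFiniteIntegral_iff_ofReal (Filter.Eventually.of_forall fun v => ?_)] at h4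
    have := Complex.re_le_norm ((rzChar n y z v : Circle) : ℂ)
    rw [Circle.norm_coe] at this
    exact sub_nonneg.2 this

end Levy

/-! ### Construction of the joint law of `(Y₀, Y₁, …)` -/

/-- The tail is at most `r/2` times the norm of the integral of `1 - charFun μ` over `[-2/r, 2/r]`.
There the integrand is at most `4K/r²`, and the interval has length `4/r`. -/
theorem measureReal_abs_gt_le_of_charFun (μ : Measure ℝ) [IsProbabilityMeasure μ] {K r : ℝ}
    (h : ∀ t, ‖1 - charFun μ t‖ ≤ K * t ^ 2) (hr : 0 < r) :
    μ.real {x | r < |x|} ≤ 8 * K / r ^ 2 := by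
  have hK : 0 ≤ K := by simpa using (norm_nonneg _).trans (h 1)
  refine (measureReal_abs_gt_le_integral_charFun hr).trans ?_
  have hr' : 0 < r⁻¹ := inv_pos.2 hr
  have h1 : ‖∫ t in (-2 * r⁻¹)..(2 * r⁻¹), 1 - charFun μ t‖ ≤
      K * (2 * r⁻¹) ^ 2 * |2 * r⁻¹ - -2 * r⁻¹| := by
    refine intervalIntegral.norm_integral_le_of_norm_le_const fun t ht => (h t).trans ?_
    rw [Set.uIoc_of_le (by linarith)] at ht
    have : t ^ 2 ≤ (2 * r⁻¹) ^ 2 := by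
      rw [sq_le_sq, abs_of_pos (by linarith : 0 < 2 * r⁻¹)]
      exact abs_le.2 ⟨by linarith [ht.1], ht.2⟩
    gcongr
  calc 2⁻¹ * r * ‖∫ t in (-2 * r⁻¹)..(2 * r⁻¹), 1 - charFun μ t‖
      ≤ 2⁻¹ * r * (K * (2 * r⁻¹) ^ 2 * |2 * r⁻¹ - -2 * r⁻¹|) := by gcongr
    _ = 8 * K / r ^ 2 := by
      rw [abs_of_pos (by linarith)]
      field_simp
      ring

theorem measurable_firstCoords (n : ℕ) : Measurable (firstCoords n) := by
  have h : Measurable fun y : ℝ × (ℕ → ℤ) => (y.1, fun k : Fin n => y.2 k) := by fun_prop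
  exact h

theorem firstCoords_add (n : ℕ) (u v : ℝ × (ℕ → ℤ)) :
    firstCoords n (u + v) = firstCoords n u * firstCoords n v := rfl

theorem firstCoords_zero (n : ℕ) : firstCoords n 0 = 1 := rfl

/-! ### Centred compound Poisson laws of pieces of finite mass -/

section Pieces

variable {p : ℕ} (η : Measure (solenoid p))

/-- The compound Poisson measure on `ℝ × ℤ^∞` of the part of a Lévy measure on the set `B`. -/
def pieceLaw (B : Set (solenoid p)) : Measure (ℝ × (ℕ → ℤ)) :=
  compoundPoisson ((η.restrict B).map (solenoidTau p))

/-- The centering constant of `pieceLaw`. -/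
def pieceShift (B : Set (solenoid p)) : ℝ × (ℕ → ℤ) :=
  (∫ x in B, truncFun (solenoidTau p x).1 ∂η, 0)

variable {η} {B : Set (solenoid p)}

theorem isProbabilityMeasure_pieceLaw (hB : η B < ∞) : IsProbabilityMeasure (pieceLaw η B) := by
  have : IsFiniteMeasure (η.restrict B) := isFiniteMeasure_restrict.2 hB.ne
  exact isProbabilityMeasure_compoundPoisson _

/-- On a piece of finite mass `χ - 1` and `h` are separately integrable. The compound Poisson law
supplies the first in the exponent, and the deterministic shift supplies the compensator. -/
theorem integral_pieceLaw (hB : η B < ∞) (n : ℕ) (y : ℝ) (z : Fin n → Circle) :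
    ∫ v, ((rzChar n y z (firstCoords n (v - pieceShift η B)) : Circle) : ℂ) ∂(pieceLaw η B) =
      Complex.exp (∫ x in B, levyIntegrand p n y z x ∂η) := by
  have : IsFiniteMeasure (η.restrict B) := isFiniteMeasure_restrict.2 hB.ne
  have hχ : Measurable fun v => ((rzChar n y z (firstCoords n v) : Circle) : ℂ) :=
    (continuous_char (rzChar n y z)).measurable.comp (measurable_firstCoords n)
  have h1 : ∀ v, ((rzChar n y z (firstCoords n (v - pieceShift η B)) : Circle) : ℂ) =
      ((rzChar n y z (firstCoords n v) : Circle) : ℂ) *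
        ((rzChar n y z (firstCoords n (-pieceShift η B)) : Circle) : ℂ) := by
    intro v
    rw [sub_eq_add_neg, firstCoords_add, map_mul, Circle.coe_mul]
  have h2 : ((rzChar n y z (firstCoords n (-pieceShift η B)) : Circle) : ℂ) =
      Complex.exp (-(Complex.I * (y * ∫ x in B, truncFun (solenoidTau p x).1 ∂η : ℝ))) := by
    rw [rzChar_apply]
    simp only [firstCoords, toAdd_ofAdd, pieceShift, Prod.fst_neg, Prod.snd_neg, neg_zero,
      Pi.zero_apply, zpow_zero, Finset.prod_const_one, mul_one, Circle.coe_exp]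
    congr 1
    push_cast
    ring
  simp_rw [h1]
  rw [integral_mul_const, h2, pieceLaw, integral_compoundPoisson
    (f := fun v => ((rzChar n y z (firstCoords n v) : Circle) : ℂ)) hχ
    (fun _ => (Circle.norm_coe _).le) (by simp [firstCoords_zero])
    (fun u v => by rw [firstCoords_add, map_mul, Circle.coe_mul]), ← Complex.exp_add]
  congr 1
  have hi : Integrable
      (fun x => ((rzChar n y z (firstCoords n (solenoidTau p x)) : Circle) : ℂ) - 1)
      (η.restrict B) :=
    (Integrable.of_bound (hχ.comp (measurable_solenoidTau p)).aestronglyMeasurable 1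
      (Filter.Eventually.of_forall fun _ => (Circle.norm_coe _).le)).sub (integrable_const 1)
  have hi2 : Integrable (fun x => Complex.I * ((y * truncFun (solenoidTau p x).1 : ℝ) : ℂ))
      (η.restrict B) := by
    refine (Integrable.ofReal (Integrable.const_mul (Integrable.of_bound
      (measurable_truncFun.comp (measurable_solenoidTau p).fst).aestronglyMeasurable Real.pi
      (Filter.Eventually.of_forall fun x => abs_truncFun_le _)) y)).const_mul _
  rw [integral_map (measurable_solenoidTau p).aemeasurable (hχ.sub_const 1).aestronglyMeasurable]
  simp only [levyIntegrand]
  rw [integral_sub hi hi2, integral_const_mul, integral_complex_ofReal, integral_const_mul,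
    sub_eq_add_neg]

/-- The characteristic function is `e^w` with `|w| ≤ 3t²s`, and `|1 - e^w| ≤ 2|w|`; the tail
estimate then applies with `K = 6s`. -/
theorem pieceLaw_real_le [Fact p.Prime] (hB : η B < ∞) (hη : IsLevyMeasure η)
    (hBm : MeasurableSet B) {m : ℕ}
    (hsub : B ⊆ nearOne p m) {s r : ℝ} (hs : ∫ x in B, (solenoidTau p x).1 ^ 2 ∂η ≤ s)
    (hr : 0 < r) :
    (pieceLaw η B).real {v | r < |(v - pieceShift η B).1|} ≤ 48 * s / r ^ 2 := by
  have := isProbabilityMeasure_pieceLaw hB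
  have hm : Measurable fun v : ℝ × (ℕ → ℤ) => (v - pieceShift η B).1 :=
    measurable_fst.sub_const _
  have : IsProbabilityMeasure ((pieceLaw η B).map fun v => (v - pieceShift η B).1) :=
    Measure.isProbabilityMeasure_map hm.aemeasurable
  have hset : MeasurableSet {x : ℝ | r < |x|} :=
    measurableSet_lt measurable_const measurable_id.abs
  have h1 := measureReal_abs_gt_le_of_charFun
    ((pieceLaw η B).map fun v => (v - pieceShift η B).1) (K := 6 * s) (r := r) ?_ hr
  · rw [map_measureReal_apply hm hset] at h1
    refine h1.trans (le_of_eq ?_)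
    ring
  intro t
  have hc : charFun ((pieceLaw η B).map fun v => (v - pieceShift η B).1) t =
      Complex.exp (∫ x in B, levyIntegrand p 0 t 1 x ∂η) := by
    rw [← integral_pieceLaw hB, charFun_apply_real, integral_map hm.aemeasurable (by fun_prop)]
    refine integral_congr_ae (Filter.Eventually.of_forall fun v => ?_)
    simp only [rzChar_apply, Finset.univ_eq_empty, Finset.prod_empty, mul_one, Circle.coe_exp]
    congr 1
    simp [firstCoords]
  have hw : ‖∫ x in B, levyIntegrand p 0 t 1 x ∂η‖ ≤ 3 * t ^ 2 * s := by
    calc ‖∫ x in B, levyIntegrand p 0 t 1 x ∂η‖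
        ≤ ∫ x in B, 3 * t ^ 2 * (solenoidTau p x).1 ^ 2 ∂η := by
          refine norm_integral_le_of_norm_le
            ((integrable_tau_sq hη).integrableOn.const_mul _) ?_
          filter_upwards [ae_restrict_mem hBm] with x hx
          rw [levyIntegrand_eq (Nat.zero_le m) t 1 (hsub hx)]
          refine (norm_exp_mul_I_sub_one_sub_le _).trans (le_of_eq ?_)
          ring
      _ ≤ 3 * t ^ 2 * s := by
          rw [integral_const_mul]
          gcongr
  set w := ∫ x in B, levyIntegrand p 0 t 1 x ∂η
  have hn : ‖Complex.exp w‖ ≤ 1 := by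
    rw [← hc]
    exact norm_charFun_le_one t
  -- For `|w| > 1` this uses `|e^w| ≤ 1`, which holds because `e^w` is a value of a characteristic
  -- function.
  have h2 : ‖1 - Complex.exp w‖ ≤ 2 * ‖w‖ := by
    rcases le_or_gt ‖w‖ 1 with h | h
    · rw [norm_sub_rev]
      exact Complex.norm_exp_sub_one_le h
    · have := norm_sub_le 1 (Complex.exp w)
      rw [norm_one] at this
      linarith
  rw [hc]
  linarith

/-- All jumps lie in the submonoid where digit `k` is `0`, hence so do their sums. -/
theorem ae_pieceLaw_snd_eq_zero [Fact p.Prime] (hBm : MeasurableSet B) (hB : η B < ∞)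
    {m k : ℕ} (hk : k < m) (hsub : B ⊆ nearOne p m) :
    ∀ᵐ v ∂(pieceLaw η B), v.2 k = 0 := by
  have : IsFiniteMeasure (η.restrict B) := isFiniteMeasure_restrict.2 hB.ne
  have hS : MeasurableSet {v : ℝ × (ℕ → ℤ) | v.2 k = 0} :=
    measurableSet_eq_fun (by fun_prop) measurable_const
  refine ae_compoundPoisson (S := {v : ℝ × (ℕ → ℤ) | v.2 k = 0}) hS rfl ?_ ?_
  · intro u hu v hv
    have h1 : u.2 k = 0 := hu
    have h2 : v.2 k = 0 := hv
    simp [h1, h2]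
  · refine (ae_map_iff (measurable_solenoidTau p).aemeasurable hS).2 ?_
    filter_upwards [ae_restrict_mem hBm] with x hx
    exact tau_snd_eq_zero p hk (hsub hx)

end Pieces

/-- The complement of the identity splits into pieces of finite measure on which the second moment
decreases geometrically. -/
theorem exists_levy_partition {p : ℕ} [Fact p.Prime] {η : Measure (solenoid p)}
    (hη : IsLevyMeasure η) : ∃ A : ℕ → Set (solenoid p), (∀ m, MeasurableSet (A m)) ∧
      Pairwise (Function.onFun Disjoint A) ∧ ⋃ m, A m = {1}ᶜ ∧ (∀ m, η (A m) < ∞) ∧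
      (∀ m, A (m + 1) ⊆ nearOne p m) ∧
      ∀ m, ∫ x in A (m + 1), (solenoidTau p x).1 ^ 2 ∂η ≤ (1 / 8 : ℝ) ^ m := by
  set f : solenoid p → ℝ≥0∞ := fun x => ENNReal.ofReal ((solenoidTau p x).1 ^ 2) with hf
  set μ := η.withDensity f with hμ
  have hfin : μ Set.univ < ∞ := by
    rw [hμ, withDensity_apply _ MeasurableSet.univ, Measure.restrict_univ]
    exact hη.lintegral_sq
  -- The second-moment measure `μ` is finite, and the sets `nearOne p n` decrease to `{1}`, which is
  -- a null set.
  have hlim : Filter.Tendsto (fun n => μ (nearOne p n)) Filter.atTop (𝓝 0) := by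
    have h := tendsto_measure_iInter_atTop (μ := μ)
      (fun n => (measurableSet_nearOne p n).nullMeasurableSet) (nearOne_antitone p)
      ⟨0, ((measure_mono (Set.subset_univ _)).trans_lt hfin).ne⟩
    have h0 : μ {1} = 0 := withDensity_absolutelyContinuous η f hη.one
    rwa [iInter_nearOne, h0] at h
  -- The ratio `1/8` is chosen so that the tail bound at threshold `2^{-m}`, namely `48 · 8^{-m} /
  -- 4^{-m} = 48 · 2^{-m}`, is summable.
  obtain ⟨N, hN, hNle⟩ := Filter.extraction_forall_of_eventually
    (P := fun m n => μ (nearOne p n) ≤ ENNReal.ofReal ((1 / 8 : ℝ) ^ m)) fun m =>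
      hlim.eventually_le_const (ENNReal.ofReal_pos.2 (by positivity))
  set U : ℕ → Set (solenoid p) := fun m => (nearOne p (N m))ᶜ with hU
  have hsub : ∀ m, disjointed U (m + 1) ⊆ nearOne p (N m) := by
    intro m x hx
    rw [disjointed_add_one] at hx
    by_contra h
    exact hx.2 (le_partialSups U m h)
  have hmeas : ∀ m, MeasurableSet (disjointed U m) := fun m =>
    MeasurableSet.disjointed (fun k => (measurableSet_nearOne p (N k)).compl) m
  refine ⟨disjointed U, hmeas, disjoint_disjointed U, ?_, ?_, ?_, ?_⟩
  · rw [iUnion_disjointed, hU, ← Set.compl_iInter, ← iInter_nearOne p]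
    congr 1
    refine Set.Subset.antisymm (fun x hx => Set.mem_iInter.2 fun n => ?_)
      (fun x hx => Set.mem_iInter.2 fun n => Set.mem_iInter.1 hx (N n))
    exact nearOne_antitone p hN.le_apply (Set.mem_iInter.1 hx n)
  · exact fun m => (measure_mono (disjointed_subset U m)).trans_lt (hη.compl_nearOne (N m))
  · exact fun m => (hsub m).trans (nearOne_antitone p hN.le_apply)
  · intro m
    rw [integral_eq_lintegral_of_nonneg_ae (Filter.Eventually.of_forall fun x => sq_nonneg _)
      ((measurable_solenoidTau p).fst.pow_const 2).aestronglyMeasurable]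
    refine ENNReal.toReal_le_of_le_ofReal (by positivity) ?_
    rw [← withDensity_apply f (hmeas _)]
    exact (measure_mono (hsub m)).trans (hNle m)

/-- The law is that of an infinite sum of independent centred pieces. All marginals come from the
same variable, so no consistency of a family of laws has to be checked. -/
theorem exists_joint_law {p : ℕ} [Fact p.Prime] {η : Measure (solenoid p)}
    (hη : IsLevyMeasure η) : ∃ Q : Measure (ℝ × (ℕ → ℤ)), IsProbabilityMeasure Q ∧
      ∀ n, IsGenPoissonMeasure (levyImage p n η) (rzInner n) (Q.map (firstCoords n)) := by
  obtain ⟨A, hAm, hAd, hAU, hAfin, hAsub, hAsq⟩ := exists_levy_partition hη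
  have hprob : ∀ m, IsProbabilityMeasure (pieceLaw η (A m)) := fun m =>
    isProbabilityMeasure_pieceLaw (hAfin m)
  set P : Measure (ℕ → ℝ × (ℕ → ℤ)) := Measure.infinitePi fun m => pieceLaw η (A m) with hP
  set D : ℕ → (ℕ → ℝ × (ℕ → ℤ)) → ℝ × (ℕ → ℤ) := fun m ω => ω m - pieceShift η (A m) with hD
  have heval : ∀ m, P.map (fun ω => ω m) = pieceLaw η (A m) := fun m =>
    Measure.infinitePi_map_eval _ m
  have hπ : ∀ m, Measurable fun ω : ℕ → ℝ × (ℕ → ℤ) => ω m := fun m => measurable_pi_apply m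
  have hDm1 : ∀ m, Measurable fun ω => (D m ω).1 := fun m =>
    (measurable_pi_apply m).fst.sub_const _
  have hDm2 : ∀ m k, Measurable fun ω => (D m ω).2 k := fun m k => by
    have h : Measurable fun ω : ℕ → ℝ × (ℕ → ℤ) => (ω m).2 k := by fun_prop
    exact h.sub_const ((pieceShift η (A m)).2 k)
  -- Borel–Cantelli: almost surely the real parts of the pieces are eventually bounded by a
  -- geometric sequence.
  have hbc : ∀ᵐ ω ∂P, ∀ᶠ m in Filter.atTop, ω ∉ {ω | (1 / 2 : ℝ) ^ m < |(D (m + 1) ω).1|} := by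
    refine ae_eventually_notMem (ne_top_of_le_ne_top (b := ∑' m : ℕ,
      ENNReal.ofReal (48 * (1 / 2 : ℝ) ^ m)) ?_ (ENNReal.tsum_le_tsum fun m => ?_))
    · exact (summable_geometric_two.mul_left 48).tsum_ofReal_ne_top
    · have h := pieceLaw_real_le (hAfin (m + 1)) hη (hAm (m + 1)) (hAsub m) (hAsq m)
        (r := (1 / 2 : ℝ) ^ m) (by positivity)
      have hset : MeasurableSet {v : ℝ × (ℕ → ℤ) | (1 / 2 : ℝ) ^ m <
          |(v - pieceShift η (A (m + 1))).1|} :=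
        measurableSet_lt measurable_const (measurable_fst.sub_const _).abs
      have h48 : 48 * (1 / 8 : ℝ) ^ m / ((1 / 2 : ℝ) ^ m) ^ 2 = 48 * (1 / 2 : ℝ) ^ m := by
        rw [div_eq_iff (by positivity), mul_assoc, ← pow_mul, ← pow_add, mul_comm m 2,
          show m + 2 * m = 3 * m by ring, pow_mul]
        norm_num
      rw [h48, ← heval (m + 1), map_measureReal_apply (hπ _) hset] at h
      exact (ENNReal.le_ofReal_iff_toReal_le (measure_ne_top _ _) (by positivity)).2 h
  have hconv : ∀ᵐ ω ∂P, ∃ l, Filter.Tendsto (fun N => ∑ m ∈ Finset.range N, (D m ω).1)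
      Filter.atTop (𝓝 l) := by
    filter_upwards [hbc] with ω hω
    have hs : Summable fun m => (D m ω).1 := by
      rw [← summable_nat_add_iff 1]
      refine Summable.of_norm_bounded_eventually_nat summable_geometric_two ?_
      filter_upwards [hω] with m hm
      exact not_lt.1 hm
    exact ⟨_, hs.hasSum.tendsto_sum_nat⟩
  obtain ⟨Y₀, hY₀m, hY₀⟩ := measurable_limit_of_tendsto_metrizable_ae
    (fun N => (Finset.measurable_fun_sum (Finset.range N) fun m _ => hDm1 m).aemeasurable) hconv
  have hzero : ∀ᵐ ω ∂P, ∀ m k, k < m → (D (m + 1) ω).2 k = 0 := by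
    simp only [ae_all_iff]
    intro m k hk
    have h := ae_pieceLaw_snd_eq_zero (hAm (m + 1)) (hAfin (m + 1)) hk (hAsub m)
    rw [← heval (m + 1)] at h
    filter_upwards [ae_of_ae_map (hπ _).aemeasurable h] with ω hω
    simpa [hD, pieceShift] using hω
  -- By `hzero`, piece `j + 1` has digit `k` equal to `0` once `j > k`; only the pieces `0, …, k +
  -- 1` contribute to this digit.
  set Y : (ℕ → ℝ × (ℕ → ℤ)) → ℝ × (ℕ → ℤ) := fun ω =>
    (Y₀ ω, fun k => ∑ m ∈ Finset.range (k + 2), (D m ω).2 k) with hY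
  have hYm : Measurable Y := hY₀m.prodMk (measurable_pi_lambda _ fun k =>
    Finset.measurable_fun_sum _ fun m _ => hDm2 m k)
  have hlim : ∀ n, ∀ᵐ ω ∂P, Filter.Tendsto
      (fun N => firstCoords n (∑ m ∈ Finset.range N, D m ω)) Filter.atTop
      (𝓝 (firstCoords n (Y ω))) := by
    intro n
    filter_upwards [hY₀, hzero] with ω h1 h2
    have h : Filter.Tendsto (fun N => ((∑ m ∈ Finset.range N, D m ω).1,
        fun k : Fin n => (∑ m ∈ Finset.range N, D m ω).2 k)) Filter.atTop
        (𝓝 ((Y ω).1, fun k : Fin n => (Y ω).2 k)) := by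
      refine Filter.Tendsto.prodMk_nhds ?_ (tendsto_pi_nhds.2 fun k => ?_)
      · simpa only [Prod.fst_sum] using h1
      · refine tendsto_const_nhds.congr' ?_
        filter_upwards [Filter.eventually_ge_atTop ((k : ℕ) + 2)] with N hN
        simp only [Prod.snd_sum, Finset.sum_apply, hY]
        refine Finset.sum_subset (Finset.range_subset_range.2 hN) fun m _ hm => ?_
        obtain ⟨j, rfl⟩ : ∃ j, m = j + 1 := ⟨m - 1, by rw [Finset.mem_range] at hm; omega⟩
        exact h2 j k (by rw [Finset.mem_range] at hm; omega)
    exact h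
  have hPY : IsProbabilityMeasure (P.map Y) := Measure.isProbabilityMeasure_map hYm.aemeasurable
  refine ⟨P.map Y, hPY, fun n => ?_⟩
  have hFm := measurable_firstCoords n
  refine ⟨Measure.isProbabilityMeasure_map hFm.aemeasurable, ?_, ?_⟩
  · intro χ
    obtain ⟨y, z, rfl⟩ := exists_rzChar_eq n χ
    exact integrable_rzIntegrand hη n y z
  intro χ
  obtain ⟨y, z, rfl⟩ := exists_rzChar_eq n χ
  change _ = Complex.exp (∫ v, rzIntegrand n y z v ∂(levyImage p n η))
  rw [integral_rzIntegrand, fourierTransform_map hFm]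
  set f : ℝ × (ℕ → ℤ) → ℂ := fun v => ((rzChar n y z (firstCoords n v) : Circle) : ℂ) with hf
  have hfm : Measurable f := (continuous_char (rzChar n y z)).measurable.comp hFm
  have hfsum : ∀ (s : Finset ℕ) (v : ℕ → ℝ × (ℕ → ℤ)), f (∑ m ∈ s, v m) = ∏ m ∈ s, f (v m) := by
    intro s v
    induction s using Finset.cons_induction with
    | empty => simp [hf, firstCoords_zero]
    | cons a s ha ih =>
      rw [Finset.sum_cons, Finset.prod_cons, ← ih]
      simp only [hf, firstCoords_add, map_mul, Circle.coe_mul]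
  rw [integral_map hYm.aemeasurable hfm.aestronglyMeasurable]
  have hpiece : ∀ m, ∫ ω, f (D m ω) ∂P =
      Complex.exp (∫ x in A m, levyIntegrand p n y z x ∂η) := by
    intro m
    rw [← integral_pieceLaw (hAfin m), ← heval m]
    exact (integral_map (hπ m).aemeasurable
      (hfm.comp (measurable_id.sub_const (pieceShift η (A m)))).aestronglyMeasurable).symm
  have hprod : ∀ N, ∫ ω, f (∑ m ∈ Finset.range N, D m ω) ∂P =
      Complex.exp (∑ m ∈ Finset.range N, ∫ x in A m, levyIntegrand p n y z x ∂η) := by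
    intro N
    have hind : ProbabilityTheory.iIndepFun (fun (i : Fin N) (ω : ℕ → ℝ × (ℕ → ℤ)) => ω i) P :=
      (ProbabilityTheory.iIndepFun_infinitePi (X := fun _ v => v)
        (fun _ => measurable_id)).precomp Fin.val_injective
    simp_rw [hfsum, Finset.prod_range]
    have h := hind.integral_fun_prod_comp
      (f := fun (i : Fin N) (v : ℝ × (ℕ → ℤ)) => f (v - pieceShift η (A i)))
      (fun i => (hπ i).aemeasurable)
      (fun i => (hfm.comp (measurable_id.sub_const _)).aestronglyMeasurable)
    rw [Complex.exp_sum, Finset.prod_range]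
    refine h.trans ?_
    exact Finset.prod_congr rfl fun i _ => hpiece i
  have hT1 : Filter.Tendsto (fun N => ∫ ω, f (∑ m ∈ Finset.range N, D m ω) ∂P) Filter.atTop
      (𝓝 (∫ ω, f (Y ω) ∂P)) := by
    refine tendsto_integral_of_dominated_convergence (fun _ => 1) (fun N => ?_)
      (integrable_const _) (fun N => Filter.Eventually.of_forall fun ω => (Circle.norm_coe _).le) ?_
    · exact (hfm.comp (Finset.measurable_fun_sum _ fun m _ =>
        (measurable_pi_apply m).sub_const _)).aestronglyMeasurable
    · filter_upwards [hlim n] with ω hω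
      exact ((continuous_char (rzChar n y z)).tendsto _).comp hω
  have hT2 : Filter.Tendsto (fun N => ∫ ω, f (∑ m ∈ Finset.range N, D m ω) ∂P) Filter.atTop
      (𝓝 (Complex.exp (∫ x, levyIntegrand p n y z x ∂η))) := by
    simp_rw [hprod]
    refine (Complex.continuous_exp.tendsto _).comp ?_
    have hs := hasSum_integral_iUnion hAm hAd (integrable_levyIntegrand hη n y z).integrableOn
    -- The pieces cover everything but the identity, which is `η`-null.
    rw [hAU, Measure.restrict_eq_self_of_ae_mem (s := ({1}ᶜ : Set (solenoid p)))
      (measure_eq_zero_iff_ae_notMem.1 hη.one)] at hs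
    exact hs.tendsto_sum_nat
  exact tendsto_nhds_unique hT1 hT2

/-! ### Transport of Gauss and Poisson laws to the solenoid -/

/-! ### Measures on the solenoid as laws of `φ(Y₀, Y₁, …)` -/

section Laws

variable {p : ℕ} [Fact p.Prime]

theorem solenoidMap_tau_add (a : solenoid p) (x : ℝ) (y : ℝ × (ℕ → ℤ)) :
    solenoidMap p ((solenoidTau p a).1 + x + y.1, fun k => (solenoidTau p a).2 k + y.2 k) =
      a * (solenoidMap p (x, 0) * solenoidMap p y) := by
  conv_rhs => rw [← solenoidMap_solenoidTau p a, ← solenoidMap_add, ← solenoidMap_add]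
  congr 1
  refine Prod.ext ?_ (funext fun k => ?_)
  · simp [add_assoc]
  · simp

theorem measurable_solenoidMap : Measurable (solenoidMap p) :=
  (continuous_solenoidMap p).measurable

theorem measurable_solenoidMap_real : Measurable fun x : ℝ => solenoidMap p (x, 0) :=
  measurable_solenoidMap.comp (measurable_id.prodMk measurable_const)

theorem isGaussMeasure_map (b : ℝ≥0) : IsGaussMeasure (solenoidForm p b)
    ((ProbabilityTheory.gaussianReal 0 b).map fun x => solenoidMap p (x, 0)) where
  prob := Measure.isProbabilityMeasure_map measurable_solenoidMap_real.aemeasurable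
  fourier χ := by
    obtain ⟨d, ℓ, rfl⟩ := exists_solenoidChar_eq p χ
    rw [fourierTransform_map measurable_solenoidMap_real]
    have h : ∀ x : ℝ, ((solenoidChar p d ℓ (solenoidMap p (x, 0)) : Circle) : ℂ) =
        Complex.exp (((ℓ / p ^ d : ℝ) : ℂ) * x * Complex.I) := by
      intro x
      rw [solenoidChar_solenoidMap, rzChar_apply]
      simp [firstCoords, Circle.coe_exp]
    simp_rw [h]
    rw [← charFun_apply_real, ProbabilityTheory.charFun_gaussianReal, solenoidForm,
      solenoidFreq_solenoidChar]
    congr 1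
    push_cast
    ring

/-- Because `φ ∘ τ = id`, the integrand for `χ_{d,ℓ}` is literally a `levyIntegrand` with `n = d`.
The law of the first `d + 1` coordinates of `Y` therefore settles this character. -/
theorem isGenPoissonMeasure_map {η : Measure (solenoid p)} (hη : IsLevyMeasure η)
    {Ω : Type*} [MeasurableSpace Ω] {P : Measure Ω} [IsProbabilityMeasure P]
    {Y : Ω → ℝ × (ℕ → ℤ)} (hY : Measurable Y)
    (hlaw : ∀ n, IsGenPoissonMeasure (levyImage p n η) (rzInner n)
      (P.map fun ω => firstCoords n (Y ω))) :
    IsGenPoissonMeasure η (solenoidInner p) (P.map fun ω => solenoidMap p (Y ω)) := by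
  have hchar : ∀ (d : ℕ) (ℓ : ℤ), (fun x => ((solenoidChar p d ℓ x : Circle) : ℂ) - 1 -
      Complex.I * ((solenoidInner p x (solenoidChar p d ℓ) : ℝ) : ℂ)) =
      levyIntegrand p d (ℓ / p ^ d)
        (fun k => Circle.exp (ℓ / p ^ d * (2 * Real.pi * p ^ (k : ℕ)))) := by
    intro d ℓ
    funext x
    rw [levyIntegrand, ← solenoidChar_solenoidMap, solenoidMap_solenoidTau, solenoidInner,
      solenoidFreq_solenoidChar]
    rfl
  have hm : Measurable fun ω => solenoidMap p (Y ω) := measurable_solenoidMap.comp hY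
  refine ⟨Measure.isProbabilityMeasure_map hm.aemeasurable, fun χ => ?_, fun χ => ?_⟩
  · obtain ⟨d, ℓ, rfl⟩ := exists_solenoidChar_eq p χ
    rw [hchar]
    exact integrable_levyIntegrand hη _ _ _
  · obtain ⟨d, ℓ, rfl⟩ := exists_solenoidChar_eq p χ
    rw [hchar, ← integral_rzIntegrand, fourierTransform_map hm]
    refine Eq.trans ?_ ((hlaw d).fourier _)
    have h := fourierTransform_map (P := P) ((measurable_firstCoords d).comp hY)
      (rzChar d (ℓ / p ^ d) fun k => Circle.exp (ℓ / p ^ d * (2 * Real.pi * p ^ (k : ℕ))))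
    refine Eq.trans ?_ h.symm
    simp_rw [solenoidChar_solenoidMap]
    rfl

theorem exists_gaussPoissonPair (b : ℝ≥0) {η : Measure (solenoid p)} (hη : IsLevyMeasure η) :
    ∃ (Ω : Type) (_ : MeasurableSpace Ω) (P : Measure Ω) (X₀ : Ω → ℝ) (Y : Ω → ℝ × (ℕ → ℤ)),
      IsProbabilityMeasure P ∧ IsGaussPoissonPair p b η P X₀ Y := by
  obtain ⟨Q, hQ, hlaw⟩ := exists_joint_law hη
  refine ⟨ℝ × (ℝ × (ℕ → ℤ)), inferInstance, (ProbabilityTheory.gaussianReal 0 b).prod Q, Prod.fst,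
    Prod.snd, inferInstance, measurable_fst, measurable_snd, ?_, ?_, fun n => ?_⟩
  · exact ProbabilityTheory.indepFun_prod measurable_id measurable_id
  · exact (measurePreserving_fst (μ := ProbabilityTheory.gaussianReal 0 b) (ν := Q)).map_eq
  · have h : ((ProbabilityTheory.gaussianReal 0 b).prod Q).map Prod.snd = Q :=
      (measurePreserving_snd (μ := ProbabilityTheory.gaussianReal 0 b) (ν := Q)).map_eq
    have h2 := Measure.map_map (μ := (ProbabilityTheory.gaussianReal 0 b).prod Q)
      (measurable_firstCoords n) measurable_snd
    rw [h] at h2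
    have h3 := hlaw n
    rw [h2] at h3
    exact h3

/-- By uniqueness, `γ` and `π` are the laws of `φ(X₀, 0)` and `φ(Y)`. Since `φ` is a homomorphism,
the variable is the product of `a` and these two, and independence factors its Fourier transform. -/
theorem map_gaussPoissonPair (a : solenoid p) {b : ℝ≥0} {η : Measure (solenoid p)}
    (hη : IsLevyMeasure η) {Ω : Type*} [MeasurableSpace Ω] {P : Measure Ω}
    [IsProbabilityMeasure P] {X₀ : Ω → ℝ} {Y : Ω → ℝ × (ℕ → ℤ)}
    (h : IsGaussPoissonPair p b η P X₀ Y) {γ π : Measure (solenoid p)}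
    (hγ : IsGaussMeasure (solenoidForm p b) γ) (hπ : IsGenPoissonMeasure η (solenoidInner p) π) :
    P.map (fun ω => solenoidMap p ((solenoidTau p a).1 + X₀ ω + (Y ω).1,
      fun k => (solenoidTau p a).2 k + (Y ω).2 k)) =
      (Measure.dirac a).mconv (γ.mconv π) := by
  have hXm : Measurable fun ω => solenoidMap p (X₀ ω, 0) :=
    measurable_solenoidMap_real.comp h.measurable_X
  have hYm : Measurable fun ω => solenoidMap p (Y ω) := measurable_solenoidMap.comp h.measurable_Y
  have hγ' : γ = P.map fun ω => solenoidMap p (X₀ ω, 0) := by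
    rw [hγ.unique (solenoid_separates p) (isGaussMeasure_map b), ← h.law_X,
      Measure.map_map measurable_solenoidMap_real h.measurable_X]
    rfl
  have hπ' : π = P.map fun ω => solenoidMap p (Y ω) :=
    hπ.unique (solenoid_separates p) (isGenPoissonMeasure_map hη h.measurable_Y h.law_Y)
  have hγp := hγ.prob
  have hπp := hπ.prob
  have hm : Measurable fun ω => a * (solenoidMap p (X₀ ω, 0) * solenoidMap p (Y ω)) :=
    (hXm.mul hYm).const_mul a
  have := Measure.isProbabilityMeasure_map (μ := P) hm.aemeasurable
  simp_rw [solenoidMap_tau_add]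
  refine ext_of_fourierTransform (solenoid_separates p) fun χ => ?_
  rw [fourierTransform_mconv, fourierTransform_mconv, fourierTransform_dirac, hγ', hπ',
    fourierTransform_map hXm, fourierTransform_map hYm, fourierTransform_map hm]
  simp only [map_mul, Circle.coe_mul, integral_const_mul]
  congr 1
  exact h.indep.integral_fun_comp_mul_comp
    (f := fun x => ((χ (solenoidMap p (x, 0)) : Circle) : ℂ))
    (g := fun y => ((χ (solenoidMap p y) : Circle) : ℂ))
    h.measurable_X.aemeasurable h.measurable_Y.aemeasurable
    ((continuous_char χ).measurable.comp measurable_solenoidMap_real).aestronglyMeasurable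
    ((continuous_char χ).measurable.comp measurable_solenoidMap).aestronglyMeasurable

end Laws

/-! ### The Haar measure -/

section Haar

variable {p : ℕ}

instance isHaarMeasure_solenoidHaar : (solenoidHaar p).IsHaarMeasure :=
  inferInstanceAs (Measure.haarMeasure ⊤).IsHaarMeasure

instance isProbabilityMeasure_solenoidHaar : IsProbabilityMeasure (solenoidHaar p) :=
  ⟨by rw [solenoidHaar, ← TopologicalSpace.PositiveCompacts.coe_top]
      exact Measure.haarMeasure_self⟩

/-- Translation by `g` with `χ(g) ≠ 1` multiplies the integral by `χ(g)` and leaves it unchanged. -/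
theorem fourierTransform_solenoidHaar {χ : PontryaginDual (solenoid p)} (hχ : χ ≠ 1) :
    fourierTransform (solenoidHaar p) χ = 0 := by
  obtain ⟨g, hg⟩ : ∃ g, χ g ≠ 1 := by
    by_contra! h
    exact hχ (PontryaginDual.ext h)
  have h := integral_mul_left_eq_self (μ := solenoidHaar p)
    (fun x => ((χ x : Circle) : ℂ)) g
  simp only [map_mul, Circle.coe_mul, integral_const_mul] at h
  have h1 : (((χ g : Circle) : ℂ) - 1) * ∫ x, ((χ x : Circle) : ℂ) ∂(solenoidHaar p) = 0 := by
    rw [sub_mul, h, one_mul, sub_self]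
  refine (mul_eq_zero.1 h1).resolve_left fun h2 => hg ?_
  exact Circle.coe_injective (sub_eq_zero.1 h2)

theorem solenoidChar_succ_mul (d : ℕ) (m : ℤ) :
    solenoidChar p (d + 1) (p * m) = solenoidChar p d m := by
  ext x
  rw [solenoidChar_apply, solenoidChar_apply, zpow_mul, zpow_natCast, ← x.2 d]

theorem solenoidChar_zero_right (d : ℕ) : solenoidChar p d 0 = 1 := by
  ext x
  rw [solenoidChar_apply, zpow_zero]
  rfl

/-- Factors `p` of `ℓ` are absorbed by lowering `d`, since `χ_{d+1,pm} = χ_{d,m}`. In reduced form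
the last digit acts through a nontrivial root of unity. -/
theorem exists_solenoidChar_reduced [Fact p.Prime] {χ : PontryaginDual (solenoid p)}
    (hχ : χ ≠ 1) : (∃ ℓ : ℤ, ℓ ≠ 0 ∧ χ = solenoidChar p 0 ℓ) ∨
      ∃ (d : ℕ) (ℓ : ℤ), ¬ (p : ℤ) ∣ ℓ ∧ χ = solenoidChar p (d + 1) ℓ := by
  obtain ⟨d, ℓ, rfl⟩ := exists_solenoidChar_eq p χ
  induction d generalizing ℓ with
  | zero =>
    refine Or.inl ⟨ℓ, ?_, rfl⟩
    rintro rfl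
    exact hχ (solenoidChar_zero_right 0)
  | succ d ih =>
    by_cases h : (p : ℤ) ∣ ℓ
    · obtain ⟨m, rfl⟩ := h
      rw [solenoidChar_succ_mul] at hχ ⊢
      exact ih m hχ
    · exact Or.inr ⟨d, ℓ, h, rfl⟩

theorem integral_uniform_Icc {Ω : Type*} [MeasurableSpace Ω] {P : Measure Ω} {U : Ω → ℝ}
    (hm : Measurable U) (hU : pdf.IsUniform U (Set.Icc 0 (2 * Real.pi)) P volume) {ℓ : ℤ}
    (hℓ : ℓ ≠ 0) : ∫ ω, Complex.exp ((ℓ : ℂ) * U ω * Complex.I) ∂P = 0 := by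
  have h : ∫ ω, Complex.exp ((ℓ : ℂ) * U ω * Complex.I) ∂P =
      ∫ x : ℝ, Complex.exp ((ℓ : ℂ) * x * Complex.I) ∂(P.map U) :=
    (integral_map hm.aemeasurable
      (f := fun x : ℝ => Complex.exp ((ℓ : ℂ) * x * Complex.I)) (by fun_prop)).symm
  rw [h, hU, ProbabilityTheory.cond, integral_smul_measure, integral_Icc_eq_integral_Ioc,
    ← intervalIntegral.integral_of_le Real.two_pi_pos.le]
  have h0 : (ℓ : ℂ) * Complex.I ≠ 0 := mul_ne_zero (Int.cast_ne_zero.2 hℓ) Complex.I_ne_zero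
  have h1 : ∀ x : ℝ, (ℓ : ℂ) * x * Complex.I = (ℓ : ℂ) * Complex.I * x := fun x => by ring
  simp_rw [h1]
  rw [integral_exp_mul_complex h0]
  have h2 : (ℓ : ℂ) * Complex.I * ((2 * Real.pi : ℝ) : ℂ) = ℓ * (2 * Real.pi * Complex.I) := by
    push_cast; ring
  rw [h2, Complex.exp_int_mul_two_pi_mul_I]
  simp

theorem integral_uniform_Ico {Ω : Type*} [MeasurableSpace Ω] {P : Measure Ω}
    {U : Ω → ℤ} (hm : Measurable U)
    (hU : pdf.IsUniform U (Set.Ico 0 (p : ℤ)) P Measure.count) {ζ : ℂ} (h1 : ζ ≠ 1)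
    (hζ : ζ ^ p = 1) : ∫ ω, ζ ^ (U ω) ∂P = 0 := by
  have h : ∫ ω, ζ ^ (U ω) ∂P = ∫ k : ℤ, ζ ^ k ∂(P.map U) :=
    (integral_map hm.aemeasurable (by fun_prop)).symm
  have hs : ∫ k in Set.Ico 0 (p : ℤ), ζ ^ k ∂Measure.count = ∑ k ∈ Finset.range p, ζ ^ k := by
    have hc : Set.Ico 0 (p : ℤ) = ((Finset.range p).map Nat.castEmbedding : Finset ℤ) := by
      ext k
      simp only [Set.mem_Ico, Finset.coe_map, Set.mem_image, Finset.coe_range, Set.mem_Iio,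
        Nat.castEmbedding_apply]
      constructor
      · rintro ⟨h0, h1⟩
        exact ⟨k.toNat, by omega, by omega⟩
      · rintro ⟨j, hj, rfl⟩
        omega
    rw [hc, setIntegral_finset]
    swap
    · rw [← Set.biUnion_of_singleton (((Finset.range p).map Nat.castEmbedding : Finset ℤ) : Set ℤ)]
      simp only [SetLike.mem_coe, integrableOn_finset_iUnion]
      intro k _
      simp
    simp [Measure.real]
  rw [h, hU, ProbabilityTheory.cond, integral_smul_measure, hs, geom_sum_eq h1, hζ]
  simp

theorem map_uniformDigits [hp : Fact p.Prime] {Ω : Type*} [MeasurableSpace Ω] {P : Measure Ω}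
    [IsProbabilityMeasure P] {U₀ : Ω → ℝ} {U : ℕ → Ω → ℤ} (h : IsUniformDigits p P U₀ U) :
    P.map (fun ω => solenoidMap p (U₀ ω, fun k => U k ω)) = solenoidHaar p := by
  have hp0 : (p : ℂ) ≠ 0 := by exact_mod_cast hp.out.ne_zero
  have hm : Measurable fun ω => solenoidMap p (U₀ ω, fun k => U k ω) :=
    measurable_solenoidMap.comp
      (h.measurable_zero.prodMk (measurable_pi_lambda _ h.measurable_succ))
  have := Measure.isProbabilityMeasure_map (μ := P) hm.aemeasurable
  refine ext_of_fourierTransform (solenoid_separates p) fun χ => ?_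
  by_cases hχ : χ = 1
  · subst hχ
    simp [fourierTransform]
  rw [fourierTransform_solenoidHaar hχ, fourierTransform_map hm]
  have hval : ∀ (d : ℕ) (ℓ : ℤ) (ω : Ω),
      ((solenoidChar p d ℓ (solenoidMap p (U₀ ω, fun k => U k ω)) : Circle) : ℂ) =
        Complex.exp (ℓ / p ^ d * U₀ ω * Complex.I) * ∏ k : Fin d,
          Complex.exp (ℓ / p ^ d * (2 * Real.pi * p ^ (k : ℕ)) * U k ω * Complex.I) := by
    intro d ℓ ω
    rw [solenoidChar_solenoidMap, rzChar_apply]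
    simp only [firstCoords, toAdd_ofAdd, Circle.coe_mul, Circle.coe_exp,
      ← Circle.exp_intCast_mul]
    congr 1
    · push_cast; ring_nf
    · refine (map_prod Circle.coeHom _ _).trans (Finset.prod_congr rfl fun k _ => ?_)
      change ((Circle.exp _ : Circle) : ℂ) = _
      rw [Circle.coe_exp]
      push_cast; ring_nf
  rcases exists_solenoidChar_reduced hχ with ⟨ℓ, hℓ, rfl⟩ | ⟨d, ℓ, hℓ, rfl⟩
  · simp_rw [hval]
    simpa using integral_uniform_Icc h.measurable_zero h.uniform_zero hℓ
  · simp_rw [hval]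
    -- These are the weights of `U₀, U₁, …` in the phase `ℓ / p^{d+1} · (U₀ + ∑ 2π p^k U_{k+1})`.
    let w : ℕ → ℂ := fun i => Nat.casesOn i 1 fun k => 2 * Real.pi * (p : ℂ) ^ k
    have hmeas : ∀ i, Measurable (realSeq U₀ U i) := by
      rintro (_ | k)
      · exact h.measurable_zero
      · exact measurable_from_top.comp (h.measurable_succ k)
    have hI := (h.indep.precomp (Fin.val_injective (n := d + 2))).integral_fun_prod_comp
      (f := fun (i : Fin (d + 2)) (x : ℝ) =>
        Complex.exp (ℓ / p ^ (d + 1) * w i * x * Complex.I))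
      (fun i => (hmeas i).aemeasurable) (fun i => by fun_prop)
    have h0 : ∏ i : Fin (d + 2), ∫ ω, Complex.exp (ℓ / p ^ (d + 1) * w i *
        realSeq U₀ U i ω * Complex.I) ∂P = 0 := by
      -- The last digit has phase coefficient `2πℓ/p`. As `p ∤ ℓ`, `ζ` is a `p`-th root of unity
      -- other than `1`, and its powers over a full residue system sum to zero.
      refine Finset.prod_eq_zero (Finset.mem_univ (Fin.last (d + 1))) ?_
      set ζ : ℂ := Complex.exp (ℓ * (2 * Real.pi * Complex.I) / p) with hζ
      have h1 : ζ ≠ 1 := by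
        rw [hζ, Ne, Complex.exp_eq_one_iff]
        rintro ⟨n, hn⟩
        apply hℓ
        rw [div_eq_iff hp0] at hn
        have h2 : (2 * Real.pi * Complex.I : ℂ) ≠ 0 := Complex.two_pi_I_ne_zero
        have h3 : (ℓ : ℂ) = n * p := mul_right_cancel₀ h2 (by linear_combination hn)
        exact ⟨n, by rw [mul_comm]; exact_mod_cast h3⟩
      have h2 : ζ ^ p = 1 := by
        rw [hζ, ← Complex.exp_nat_mul, mul_div_cancel₀ _ hp0]
        exact Complex.exp_int_mul_two_pi_mul_I ℓ
      rw [← integral_uniform_Ico (h.measurable_succ d) (h.uniform_succ d) h1 h2]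
      refine integral_congr_ae (Filter.Eventually.of_forall fun ω => ?_)
      simp only [hζ, ← Complex.exp_int_mul]
      congr 1
      simp only [Fin.val_last, w, realSeq]
      push_cast
      field_simp
      ring
    rw [h0] at hI
    rw [← hI]
    refine integral_congr_ae (Filter.Eventually.of_forall fun ω => ?_)
    simp only [Fin.prod_univ_succ (n := d + 1)]
    simp [w, realSeq]

/-- The laws of the real variables `U₀, U₁, …`. -/
def digitLaw (p : ℕ) : ℕ → Measure ℝ
  | 0 => ProbabilityTheory.cond volume (Set.Icc 0 (2 * Real.pi))
  | _ + 1 => (ProbabilityTheory.cond Measure.count (Set.Ico 0 (p : ℤ))).map ((↑) : ℤ → ℝ)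

theorem exists_uniformDigits [hp : Fact p.Prime] :
    ∃ (Ω : Type) (_ : MeasurableSpace Ω) (P : Measure Ω) (U₀ : Ω → ℝ) (U : ℕ → Ω → ℤ),
      IsProbabilityMeasure P ∧ IsUniformDigits p P U₀ U := by
  have hc : Measurable ((↑) : ℤ → ℝ) := measurable_from_top
  have h2 : IsProbabilityMeasure
      (ProbabilityTheory.cond Measure.count (Set.Ico 0 (p : ℤ))) := by
    refine ProbabilityTheory.cond_isProbabilityMeasure_of_finite ?_ ?_
    · rw [Ne, Measure.count_eq_zero_iff]
      exact (Set.nonempty_Ico.2 (by exact_mod_cast hp.out.pos)).ne_empty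
    · exact (Measure.count_apply_lt_top.2 (Set.finite_Ico _ _)).ne
  have hprob : ∀ i, IsProbabilityMeasure (digitLaw p i) := by
    rintro (_ | k)
    · refine ProbabilityTheory.cond_isProbabilityMeasure_of_finite ?_ ?_
      · simp [Real.pi_pos]
      · exact measure_Icc_lt_top.ne
    · exact Measure.isProbabilityMeasure_map hc.aemeasurable
  have hπ : ∀ i, Measurable fun ω : ℕ → ℝ => ω i := fun i => measurable_pi_apply i
  -- The product space is real in every coordinate, as `realSeq` requires; the floor recovers the
  -- integer digits.
  have hU : ∀ k, Measurable fun ω : ℕ → ℝ => ⌊ω (k + 1)⌋ := fun k => (hπ (k + 1)).floor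
  refine ⟨ℕ → ℝ, inferInstance, Measure.infinitePi (digitLaw p), fun ω => ω 0,
    fun k ω => ⌊ω (k + 1)⌋, inferInstance, hπ 0, hU, ?_, ?_, fun k => ?_⟩
  · let X : ℕ → ℝ → ℝ := fun i => Nat.casesOn i id fun _ x => (⌊x⌋ : ℝ)
    have hX : ∀ i, Measurable (X i) := by
      rintro (_ | k)
      · exact measurable_id
      · exact hc.comp measurable_id.floor
    have h := ProbabilityTheory.iIndepFun_infinitePi (P := digitLaw p) hX
    have he : realSeq (fun ω : ℕ → ℝ => ω 0) (fun k ω => ⌊ω (k + 1)⌋) =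
        fun i ω => X i (ω i) := by
      funext i
      cases i <;> rfl
    rwa [he]
  · exact Measure.infinitePi_map_eval (digitLaw p) 0
  · have h1 := Measure.infinitePi_map_eval (digitLaw p) (k + 1)
    have h3 := Measure.map_map (μ := Measure.infinitePi (digitLaw p)) Int.measurable_floor
      (hπ (k + 1))
    refine Eq.trans h3.symm ?_
    rw [h1, digitLaw, Measure.map_map Int.measurable_floor hc]
    have : (Int.floor : ℝ → ℤ) ∘ ((↑) : ℤ → ℝ) = id := by
      funext k
      simp
    rw [this, Measure.map_id]

end Haar

end

/-! ### The theorem -/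

theorem theorem5p1 (p : ℕ) [Fact p.Prime] :
    (Continuous (solenoidMap p) ∧ Function.Surjective (solenoidMap p) ∧
      ∀ u v, solenoidMap p (u + v) = solenoidMap p u * solenoidMap p v) ∧
    (∀ (a : solenoid p) (b : ℝ≥0) (η : Measure (solenoid p)), IsLevyMeasure η →
      IsQuadraticForm (solenoidForm p b) ∧
      (∃! γ, IsGaussMeasure (solenoidForm p b) γ) ∧
      (∃! π, IsGenPoissonMeasure η (solenoidInner p) π) ∧
      (∀ n, IsLevyMeasure (levyImage p n η) ∧
        ∃! π, IsGenPoissonMeasure (levyImage p n η) (rzInner n) π) ∧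
      (∃ (Ω : Type) (_ : MeasurableSpace Ω) (P : Measure Ω) (X₀ : Ω → ℝ) (Y : Ω → ℝ × (ℕ → ℤ)),
        IsProbabilityMeasure P ∧ IsGaussPoissonPair p b η P X₀ Y) ∧
      ∀ (Ω : Type*) [MeasurableSpace Ω] (P : Measure Ω) [IsProbabilityMeasure P]
        (X₀ : Ω → ℝ) (Y : Ω → ℝ × (ℕ → ℤ)), IsGaussPoissonPair p b η P X₀ Y →
        (∀ ω j,
          (solenoidMap p ((solenoidTau p a).1 + X₀ ω + (Y ω).1,
            fun k => (solenoidTau p a).2 k + (Y ω).2 k)).1 j =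
          a.1 j * Circle.exp ((X₀ ω + (Y ω).1 +
            ∑ k ∈ Finset.range j, 2 * Real.pi * ((Y ω).2 k : ℝ) * (p : ℝ) ^ k) / (p : ℝ) ^ j)) ∧
        ∀ γ π : Measure (solenoid p), IsGaussMeasure (solenoidForm p b) γ →
          IsGenPoissonMeasure η (solenoidInner p) π →
          P.map (fun ω => solenoidMap p ((solenoidTau p a).1 + X₀ ω + (Y ω).1,
              fun k => (solenoidTau p a).2 k + (Y ω).2 k)) =
            (Measure.dirac a).mconv (γ.mconv π)) ∧
    (∃ (Ω : Type) (_ : MeasurableSpace Ω) (P : Measure Ω) (U₀ : Ω → ℝ) (U : ℕ → Ω → ℤ),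
      IsProbabilityMeasure P ∧ IsUniformDigits p P U₀ U) ∧
    (∀ (Ω : Type*) [MeasurableSpace Ω] (P : Measure Ω) [IsProbabilityMeasure P]
      (U₀ : Ω → ℝ) (U : ℕ → Ω → ℤ), IsUniformDigits p P U₀ U →
      P.map (fun ω => solenoidMap p (U₀ ω, fun k => U k ω)) = solenoidHaar p) := by
  refine ⟨⟨continuous_solenoidMap p, fun x => ⟨_, solenoidMap_solenoidTau p x⟩,
    solenoidMap_add p⟩, ?_, exists_uniformDigits, ?_⟩
  · intro a b η hη
    refine ⟨isQuadraticForm_solenoidForm p b,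
      ⟨_, isGaussMeasure_map b, fun γ hγ => hγ.unique (solenoid_separates p)
        (isGaussMeasure_map b)⟩, ?_, fun n => ⟨isLevyMeasure_levyImage hη n, ?_⟩,
      exists_gaussPoissonPair b hη, ?_⟩
    -- The measure `π_{η,g}` on the solenoid is obtained as the image under `φ` of the joint law.
    · obtain ⟨Q, hQ, hlaw⟩ := exists_joint_law hη
      have h := isGenPoissonMeasure_map hη (P := Q) measurable_id hlaw
      exact ⟨_, h, fun π hπ => hπ.unique (solenoid_separates p) h⟩
    · obtain ⟨Q, hQ, hlaw⟩ := exists_joint_law hη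
      exact ⟨_, hlaw n, fun π hπ => hπ.unique (rz_separates n) (hlaw n)⟩
    · intro Ω _ P _ X₀ Y h
      refine ⟨fun ω j => ?_, fun γ π hγ hπ => map_gaussPoissonPair a hη h hγ hπ⟩
      rw [solenoidMap_tau_add, ← solenoidMap_add]
      simp [solenoidMap_coe]
  · intro Ω _ P _ U₀ U h
    exact map_uniformDigits h
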